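/- **Theorem 2.2.** Let $\alpha_0,\dots,\alpha_6\in\mathbb C$ satisfy $$\alpha_0+\alpha_1+2\alpha_2+2\alpha_3+2\alpha_4+\alpha_5+\alpha_6=1 .$$ For a polynomial $H\in\mathbb C(t)[x,y,z,w,q,p]$ consider the Hamiltonian system $$\frac{dx}{dt}=\frac{\partial H}{\partial y},\quad \frac{dy}{dt}=-\frac{\partial H}{\partial x},\quad \frac{dz}{dt}=\frac{\partial H}{\partial w},\quad \frac{dw}{dt}=-\frac{\partial H}{\partial z},\quad \frac{dq}{dt}=\frac{\partial H}{\partial p},\quad \frac{dp}{dt}=-\frac{\partial H}{\partial q}.$$ Assume: (A1) $H$ has total degree $4$ in $x,y,z,w,q,p$. (A2) In each of the following coordinate systems $(x_j,y_j,z_j,w_j,q_j,p_j)$, $j=0,1,2,3,5,6$ (coordinates that are not listed are unchanged), the system is again a polynomial Hamiltonian system, that is, there is $G_j\in\mathbb C(t)[x_j,y_j,z_j,w_j,q_j,p_j]$ with $\frac{dx_j}{dt}=\frac{\partial G_j}{\partial y_j}$, $\frac{dy_j}{dt}=-\frac{\partial G_j}{\partial x_j}$, and likewise for $(z_j,w_j)$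 and $(q_j,p_j)$: $$\begin{aligned} r_0&:\ x_0=1/x,\quad y_0=-((y-1)x+\alpha_0)x;\\ r_1&:\ x_1=1/x,\quad y_1=-(yx+\alpha_1)x;\\ r_2&:\ x_2=-((x-z)y-\alpha_2)y,\quad y_2=1/y,\quad w_2=w+y;\\ r_3&:\ z_3=1/z,\quad w_3=-(wz+\alpha_3)z;\\ r_5&:\ q_5=1/q,\quad p_5=-(pq+\alpha_5)q;\\ r_6&:\ q_6=1/q,\quad p_6=-((p-t)q+\alpha_6)q. \end{aligned}$$ (A3) The system written in the coordinates $r_3$ is again a polynomial Hamiltonian system, in the same sense, in the coordinates $$r_4:\ x_4=x_3,\quad y_4=y_3,\quad z_4=-((z_3-q_3)w_3-\alpha_4)w_3,\quad w_4=1/w_3,\quad q_4=q_3,\quad p_4=p_3+w_3 .$$ Then, up to an additive term $c\in\mathbb C(t)$ (which does not affect the system), $H$ equals $$\begin{aligned} H_{D_6}={}&\frac{x^2(y-1)y+x\{(\alpha_0+\alpha_1)y-\alpha_1\}+ty}{t}\\ &+\frac{z^2(w-1)w+z\{(\alpha_0+\alpha_1+2\alpha_2+2\alpha_3)w-\alpha_3\}+tw}{t}\\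 &+\frac{q^2(p-t)p+q\{(\alpha_5+\alpha_6-1)p-t\alpha_5\}+p}{t}+\frac{2yz(zw+\alpha_3)}{t}-\frac{2(y+w)p}{t}, \end{aligned}$$ and the system is $$\begin{aligned} t\,\tfrac{dx}{dt}&=2x^2y+2z^2w-x^2+(\alpha_0+\alpha_1)x+2\alpha_3z-2p+t,\\ t\,\tfrac{dy}{dt}&=-2xy^2+2xy-(\alpha_0+\alpha_1)y+\alpha_1,\\ t\,\tfrac{dz}{dt}&=2z^2w+2yz^2-z^2-(2\alpha_4-1+\alpha_5+\alpha_6)z-2p+t,\\ t\,\tfrac{dw}{dt}&=-2zw^2-4yzw+2zw-2\alpha_3y+(2\alpha_4-1+\alpha_5+\alpha_6)w+\alpha_3,\\ t\,\tfrac{dq}{dt}&=2q^2p-tq^2-2y-2w+(\alpha_5+\alpha_6-1)q+1,\\ t\,\tfrac{dp}{dt}&=-2qp^2+2tqp-(\alpha_5+\alpha_6-1)p+t\alpha_5 . \end{aligned}$$ Conversely, every $H_{D_6}+c$ with $c\in\mathbb C(t)$ satisfies (A1), (A2) and (A3). -/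

import Mathlib

open MvPolynomial

noncomputable section

namespace CoupledPIII

/-- The field `ℂ(t)` of rational functions of the time `t`. -/
abbrev TimeField : Type := RatFunc ℂ

/-- The ring `ℂ(t)[x, y, z, w, q, p]`. The variables `x, y, z, w, q, p` have the indices
`0, 1, 2, 3, 4, 5`, and `(x, y)`, `(z, w)`, `(q, p)` are the canonical pairs. -/
abbrev PolyRing : Type := MvPolynomial (Fin 6) TimeField

/-- The field `ℂ(t)(x, y, z, w, q, p)`. -/
abbrev PhaseField : Type := FractionRing PolyRing

/-- The time `t` as an element of `ℂ(t)`. -/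
def time : TimeField := RatFunc.X

/-- The time `t` as an element of `ℂ(t)(x, y, z, w, q, p)`. -/
def tt : PhaseField := algebraMap TimeField PhaseField time

/-- The original coordinates `(x, y, z, w, q, p)` as elements of `ℂ(t)(x, y, z, w, q, p)`. -/
def coords : Fin 6 → PhaseField := fun i => algebraMap PolyRing PhaseField (X i)

/-- The right-hand sides `(∂G/∂y, -∂G/∂x, ∂G/∂w, -∂G/∂z, ∂G/∂p, -∂G/∂q)` of the Hamiltonian
system with Hamiltonian `G`. -/
def hamVector (G : PolyRing) : Fin 6 → PolyRing :=
  ![pderiv 1 G, -pderiv 0 G, pderiv 3 G, -pderiv 2 G, pderiv 5 G, -pderiv 4 G]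

/-- A ring homomorphism `f ↦ f + ε D f` into the dual numbers, for the total derivative `D`
along `dx_i/dt = v i`. -/
theorem exists_dual_hom (v : Fin 6 → PhaseField) :
    ∃ φ : PhaseField →ₐ[ℂ] TrivSqZeroExt PhaseField PhaseField,
      (∀ f, (φ f).fst = f) ∧ (φ tt).snd = 1 ∧ ∀ i, (φ (coords i)).snd = v i := by
  let T := TrivSqZeroExt PhaseField PhaseField
  have hunit : ∀ a : T, a.fst ≠ 0 → IsUnit a := fun a ha =>
    TrivSqZeroExt.isUnit_iff_isUnit_fst.2 (isUnit_iff_ne_zero.2 ha)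
  have hpair : ∀ b c : PhaseField, ∃ e : T, e.fst = b ∧ e.snd = c := fun b c => ⟨(b, c), rfl, rfl⟩
  obtain ⟨e₀, he₀, he₀'⟩ := hpair tt 1
  choose e he he' using fun i => hpair (coords i) (v i)
  let φ₀ : Polynomial ℂ →+* T := (Polynomial.aeval (R := ℂ) e₀).toRingHom
  have h0 : (TrivSqZeroExt.fstHom ℂ PhaseField PhaseField).toRingHom.comp φ₀ =
      (algebraMap TimeField PhaseField).comp (algebraMap (Polynomial ℂ) TimeField) := by
    apply Polynomial.ringHom_ext
    · intro a
      simp [φ₀]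
      rfl
    · simp [φ₀, he₀, tt, time]
  have hφ₀ : ∀ y : nonZeroDivisors (Polynomial ℂ), IsUnit (φ₀ y) := by
    intro y
    apply hunit
    have := RingHom.congr_fun h0 (y : Polynomial ℂ)
    change (φ₀ y).fst = _ at this
    rw [this]
    simp
  let φ₁ : TimeField →+* T := IsLocalization.lift (M := nonZeroDivisors (Polynomial ℂ)) hφ₀
  have h1 : (TrivSqZeroExt.fstHom ℂ PhaseField PhaseField).toRingHom.comp φ₁ =
      algebraMap TimeField PhaseField := by
    apply IsLocalization.ringHom_ext (nonZeroDivisors (Polynomial ℂ))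
    rw [RingHom.comp_assoc, IsLocalization.lift_comp, h0]
  let φ₂ : PolyRing →+* T := eval₂Hom φ₁ e
  have h2 : (TrivSqZeroExt.fstHom ℂ PhaseField PhaseField).toRingHom.comp φ₂ =
      algebraMap PolyRing PhaseField := by
    apply MvPolynomial.ringHom_ext
    · intro a
      have := RingHom.congr_fun h1 a
      simp only [RingHom.comp_apply] at this ⊢
      simp only [φ₂, coe_eval₂Hom, eval₂_C, this]
      rfl
    · intro i
      simp [φ₂, he, coords]
  have hφ₂ : ∀ y : nonZeroDivisors PolyRing, IsUnit (φ₂ y) := by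
    intro y
    apply hunit
    have := RingHom.congr_fun h2 (y : PolyRing)
    change (φ₂ y).fst = _ at this
    rw [this]
    simp
  let φ₃ : PhaseField →+* T := IsLocalization.lift (M := nonZeroDivisors PolyRing) hφ₂
  have h3 : (TrivSqZeroExt.fstHom ℂ PhaseField PhaseField).toRingHom.comp φ₃ =
      RingHom.id PhaseField := by
    apply IsLocalization.ringHom_ext (nonZeroDivisors PolyRing)
    rw [RingHom.comp_assoc, IsLocalization.lift_comp, h2]
    rfl
  have e3 : ∀ a : PolyRing, φ₃ (algebraMap PolyRing PhaseField a) = φ₂ a := fun a =>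
    IsLocalization.lift_eq hφ₂ a
  have eC : ∀ a : TimeField, φ₃ (algebraMap TimeField PhaseField a) = φ₁ a := by
    intro a
    rw [IsScalarTower.algebraMap_apply TimeField PolyRing PhaseField, e3]
    simp [φ₂, MvPolynomial.algebraMap_eq]
  have e1 : ∀ a : Polynomial ℂ, φ₁ (algebraMap (Polynomial ℂ) TimeField a) = φ₀ a := fun a =>
    IsLocalization.lift_eq hφ₀ a
  refine ⟨{ φ₃ with commutes' := ?_ }, ?_, ?_, ?_⟩
  · intro r
    change φ₃ (algebraMap ℂ PhaseField r) = _
    rw [IsScalarTower.algebraMap_apply ℂ TimeField PhaseField, eC,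
      IsScalarTower.algebraMap_apply ℂ (Polynomial ℂ) TimeField, e1]
    simp [φ₀]
    rfl
  · intro f
    exact RingHom.congr_fun h3 f
  · change (φ₃ tt).snd = 1
    rw [tt, eC, time, ← RatFunc.algebraMap_X, e1]
    simp [φ₀, he₀']
  · intro i
    change (φ₃ (coords i)).snd = v i
    rw [coords, e3]
    simp [φ₂, he']

theorem exists_totalDeriv (v : Fin 6 → PhaseField) :
    ∃ D : Derivation ℂ PhaseField PhaseField, D tt = 1 ∧ ∀ i, D (coords i) = v i := by
  obtain ⟨φ, h1, h2, h3⟩ := exists_dual_hom v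
  refine ⟨Derivation.mk' ((TrivSqZeroExt.sndHom PhaseField PhaseField).restrictScalars ℂ ∘ₗ
    φ.toLinearMap) ?_, h2, h3⟩
  intro a b
  simp [h1, mul_comm]

/-- The total time derivative `d/dt` on `ℂ(t)(x, y, z, w, q, p)` along the system
`dx_i/dt = v i`: the (unique) `ℂ`-derivation with `t ↦ 1` and `x_i ↦ v i`. -/
def totalDeriv (v : Fin 6 → PhaseField) : Derivation ℂ PhaseField PhaseField :=
  (exists_totalDeriv v).choose

theorem totalDeriv_time (v : Fin 6 → PhaseField) : totalDeriv v tt = 1 :=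
  (exists_totalDeriv v).choose_spec.1

theorem totalDeriv_coords (v : Fin 6 → PhaseField) (i : Fin 6) :
    totalDeriv v (coords i) = v i :=
  (exists_totalDeriv v).choose_spec.2 i

/-- The time derivative `d/dt` along the Hamiltonian system with Hamiltonian `H`, that is,
along `dx/dt = ∂H/∂y`, `dy/dt = -∂H/∂x`, and so on. -/
def hamDeriv (H : PolyRing) : Derivation ℂ PhaseField PhaseField :=
  totalDeriv fun i => algebraMap PolyRing PhaseField (hamVector H i)

/-- In the coordinates `u` (rational functions of `t, x, y, z, w, q, p`) the system with time
derivative `D` is the Hamiltonian system of some polynomial `G ∈ ℂ(t)[u₀, …, u₅]`: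
`du₀/dt = ∂G/∂u₁`, `du₁/dt = -∂G/∂u₀`, and so on. -/
def IsPolyHamiltonianIn (D : Derivation ℂ PhaseField PhaseField) (u : Fin 6 → PhaseField) :
    Prop :=
  ∃ G : PolyRing, ∀ i, D (u i) = aeval u (hamVector G i)

/-- A complex number as a constant of `ℂ(t)(x, y, z, w, q, p)`. -/
def con (a : ℂ) : PhaseField := algebraMap ℂ PhaseField a

/-- The coordinate change `r₀`, applied to a coordinate system `u = (x, y, z, w, q, p)`. -/
def r0 (a : Fin 7 → ℂ) (u : Fin 6 → PhaseField) : Fin 6 → PhaseField :=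
  ![1 / u 0, -((u 1 - 1) * u 0 + con (a 0)) * u 0, u 2, u 3, u 4, u 5]

/-- The coordinate change `r₁`, applied to a coordinate system `u = (x, y, z, w, q, p)`. -/
def r1 (a : Fin 7 → ℂ) (u : Fin 6 → PhaseField) : Fin 6 → PhaseField :=
  ![1 / u 0, -(u 1 * u 0 + con (a 1)) * u 0, u 2, u 3, u 4, u 5]

/-- The coordinate change `r₂`, applied to a coordinate system `u = (x, y, z, w, q, p)`. -/
def r2 (a : Fin 7 → ℂ) (u : Fin 6 → PhaseField) : Fin 6 → PhaseField :=
  ![-((u 0 - u 2) * u 1 - con (a 2)) * u 1, 1 / u 1, u 2, u 3 + u 1, u 4, u 5]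

/-- The coordinate change `r₃`, applied to a coordinate system `u = (x, y, z, w, q, p)`. -/
def r3 (a : Fin 7 → ℂ) (u : Fin 6 → PhaseField) : Fin 6 → PhaseField :=
  ![u 0, u 1, 1 / u 2, -(u 3 * u 2 + con (a 3)) * u 2, u 4, u 5]

/-- The coordinate change `r₄`, applied to a coordinate system `u = (x, y, z, w, q, p)`. It is
used on top of `r₃`, that is, as `r4 a (r3 a coords)`. -/
def r4 (a : Fin 7 → ℂ) (u : Fin 6 → PhaseField) : Fin 6 → PhaseField :=
  ![u 0, u 1, -((u 2 - u 4) * u 3 - con (a 4)) * u 3, 1 / u 3, u 4, u 5 + u 3]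

/-- The coordinate change `r₅`, applied to a coordinate system `u = (x, y, z, w, q, p)`. -/
def r5 (a : Fin 7 → ℂ) (u : Fin 6 → PhaseField) : Fin 6 → PhaseField :=
  ![u 0, u 1, u 2, u 3, 1 / u 4, -(u 5 * u 4 + con (a 5)) * u 4]

/-- The coordinate change `r₆`, applied to a coordinate system `u = (x, y, z, w, q, p)`. -/
def r6 (a : Fin 7 → ℂ) (u : Fin 6 → PhaseField) : Fin 6 → PhaseField :=
  ![u 0, u 1, u 2, u 3, 1 / u 4, -((u 5 - tt) * u 4 + con (a 6)) * u 4]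

/-- The three assumptions on a Hamiltonian `H ∈ ℂ(t)[x, y, z, w, q, p]`: it has degree `4`; its
Hamiltonian system is again a polynomial Hamiltonian system in each of the coordinate systems
`r₀, r₁, r₂, r₃, r₅, r₆`; and the system written in the coordinates `r₃` is again a polynomial
Hamiltonian system in the coordinates `r₄` built from those of `r₃`. -/
structure Assumptions (a : Fin 7 → ℂ) (H : PolyRing) : Prop where
  degree : H.totalDegree = 4
  chart0 : IsPolyHamiltonianIn (hamDeriv H) (r0 a coords)
  chart1 : IsPolyHamiltonianIn (hamDeriv H) (r1 a coords)
  chart2 : IsPolyHamiltonianIn (hamDeriv H) (r2 a coords)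
  chart3 : IsPolyHamiltonianIn (hamDeriv H) (r3 a coords)
  chart5 : IsPolyHamiltonianIn (hamDeriv H) (r5 a coords)
  chart6 : IsPolyHamiltonianIn (hamDeriv H) (r6 a coords)
  chart34 : IsPolyHamiltonianIn (hamDeriv H) (r4 a (r3 a coords))

/-- The polynomial Hamiltonian of the coupled Painlevé III system of type `D₆⁽¹⁾`. -/
def hamD6 (a : Fin 7 → ℂ) : PolyRing :=
  let x : PolyRing := X 0
  let y : PolyRing := X 1
  let z : PolyRing := X 2
  let w : PolyRing := X 3
  let q : PolyRing := X 4
  let p : PolyRing := X 5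
  let t : PolyRing := C time
  let α : Fin 7 → PolyRing := fun i => algebraMap ℂ PolyRing (a i)
  C time⁻¹ *
    ((x ^ 2 * (y - 1) * y + x * ((α 0 + α 1) * y - α 1) + t * y)
      + (z ^ 2 * (w - 1) * w + z * ((α 0 + α 1 + 2 * α 2 + 2 * α 3) * w - α 3) + t * w)
      + (q ^ 2 * (p - t) * p + q * ((α 5 + α 6 - 1) * p - t * α 5) + p)
      + 2 * y * z * (z * w + α 3) - 2 * (y + w) * p)

/-- The right-hand sides of the coupled Painlevé III system of type `D₆⁽¹⁾`. -/
def systemD6 (a : Fin 7 → ℂ) : Fin 6 → PhaseField :=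
  let x := coords 0
  let y := coords 1
  let z := coords 2
  let w := coords 3
  let q := coords 4
  let p := coords 5
  let t := tt
  let α : Fin 7 → PhaseField := fun i => con (a i)
  ![(2 * x ^ 2 * y + 2 * z ^ 2 * w - x ^ 2 + (α 0 + α 1) * x + 2 * α 3 * z - 2 * p + t) / t,
    (-2 * x * y ^ 2 + 2 * x * y - (α 0 + α 1) * y + α 1) / t,
    (2 * z ^ 2 * w + 2 * y * z ^ 2 - z ^ 2 - (2 * α 4 - 1 + α 5 + α 6) * z - 2 * p + t) / t,
    (-2 * z * w ^ 2 - 4 * y * z * w + 2 * z * w - 2 * α 3 * y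
      + (2 * α 4 - 1 + α 5 + α 6) * w + α 3) / t,
    (2 * q ^ 2 * p - t * q ^ 2 - 2 * y - 2 * w + (α 5 + α 6 - 1) * q + 1) / t,
    (-2 * q * p ^ 2 + 2 * t * q * p - (α 5 + α 6 - 1) * p + t * α 5) / t]

end CoupledPIII

end

noncomputable section

namespace CoupledPIII

/-! Every chart is a canonical transformation over ℂ(t). Passing to it changes the Hamiltonian only
by a term f that generates the explicit time dependence of the chart. So the system is polynomial
Hamiltonian in a chart u exactly when H + f is a polynomial in u (`isPolyHamiltonianIn_iff`). Here f
= q for r_6, where t enters, and f = 0 for all other charts.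

With this criterion, H_{D_6} + c satisfies (A2) and (A3) as soon as H_{D_6} + f is written as a
polynomial in each chart. The normalisation of the parameters is needed for r_4 on top of r_3: there
the poles of t H_{D_6} cancel up to (1 - Σ) q / w_4, where Σ is the weighted sum of the parameters.

For uniqueness, let K = H - H_{D_6}. The terms f cancel, so K has degree at most 4 and is a
polynomial in every chart (`IsRegular`); the claim is that K is constant. Each chart has one
coordinate that is the reciprocal of a polynomial, and restricting K to the locus where its
conjugate coordinate is 0 gives a Laurent expansion whose polar part must vanish. The charts with
poles in x, z and q leave few monomials and some linear relations (`exists_form_of_isRegular`). The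
chart r_2 couples (x, y) to (z, w) and removes most of the rest
(`exists_reduced_form_of_isRegular`). The chart r_4 over r_3 couples (z, w) to (q, p) and forces the
leading coefficients of the xy-, zw- and qp-parts to be one number e (`relations_of_chart34`). The
last relation among the linear coefficients then reads e Σ = 0. Since Σ = 1, e vanishes, and one
leftover parameter is removed by a further evaluation (`eval_eq_const_of_isRegular`). -/

/-! ### Derivations of the phase field and the chain rule -/

theorem derivation_div_eq_zero {A : Type*} [Field A] [Algebra ℂ A] (D : Derivation ℂ A A) {a b : A}
    (ha : D a = 0) (hb : D b = 0) : D (a / b) = 0 := by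
  rw [div_eq_mul_inv, Derivation.leibniz, Derivation.leibniz_inv, ha, hb]
  simp

theorem derivation_algebraMap_timeField (D : Derivation ℂ PhaseField PhaseField) (hD : D tt = 0)
    (r : TimeField) : D (algebraMap TimeField PhaseField r) = 0 := by
  have hpoly : ∀ f : Polynomial ℂ,
      D (algebraMap TimeField PhaseField (algebraMap (Polynomial ℂ) TimeField f)) = 0 := by
    intro f
    induction f using Polynomial.induction_on' with
    | add f g hf hg => rw [map_add, map_add, map_add, hf, hg, add_zero]
    | monomial n c =>
      rw [← Polynomial.C_mul_X_pow_eq_monomial, map_mul, map_mul, map_pow, map_pow,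
        RatFunc.algebraMap_X, Derivation.leibniz, Derivation.leibniz_pow]
      have h1 : algebraMap TimeField PhaseField RatFunc.X = tt := rfl
      have h2 : algebraMap TimeField PhaseField
          (algebraMap (Polynomial ℂ) TimeField (Polynomial.C c)) = algebraMap ℂ PhaseField c := by
        rw [Polynomial.C_eq_algebraMap, ← IsScalarTower.algebraMap_apply,
          ← IsScalarTower.algebraMap_apply]
      rw [h1, h2, hD, Derivation.map_algebraMap]
      simp
  obtain ⟨f, g, -, rfl⟩ := IsFractionRing.div_surjective (A := Polynomial ℂ) r
  rw [map_div₀]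
  exact derivation_div_eq_zero D (hpoly f) (hpoly g)

theorem algebraMap_C (r : TimeField) :
    algebraMap PolyRing PhaseField (C r) = algebraMap TimeField PhaseField r :=
  (IsScalarTower.algebraMap_apply TimeField PolyRing PhaseField r).symm

/-- The chain rule for a derivation killing `ℂ(t)`. -/
theorem derivation_aeval (D : Derivation ℂ PhaseField PhaseField) (hD : D tt = 0)
    (u : Fin 6 → PhaseField) (G : PolyRing) :
    D (aeval u G) = ∑ j, aeval u (pderiv j G) * D (u j) := by
  induction G using MvPolynomial.induction_on with
  | C r => simp [derivation_algebraMap_timeField D hD]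
  | add f g hf hg => simp only [map_add, hf, hg, add_mul, Finset.sum_add_distrib]
  | mul_X f i hf =>
    simp only [map_mul, Derivation.leibniz, hf, pderiv_X, aeval_X, map_add, smul_eq_mul, add_mul,
      Finset.sum_add_distrib, Finset.mul_sum]
    congr 1
    · rw [Finset.sum_eq_single i]
      · simp
      · intro b _ hb
        simp [hb]
      · simp
    · exact Finset.sum_congr rfl fun j _ => by ring

theorem aeval_coords (G : PolyRing) : aeval coords G = algebraMap PolyRing PhaseField G := by
  have h : (aeval coords : PolyRing →ₐ[TimeField] PhaseField) =
      IsScalarTower.toAlgHom TimeField PolyRing PhaseField := by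
    apply MvPolynomial.algHom_ext
    intro i
    simp [coords]
  exact DFunLike.congr_fun h G

theorem derivation_eq_zero (D : Derivation ℂ PhaseField PhaseField) (hD : D tt = 0)
    (h : ∀ i, D (coords i) = 0) (f : PhaseField) : D f = 0 := by
  have hpoly : ∀ g : PolyRing, D (algebraMap PolyRing PhaseField g) = 0 := fun g => by
    rw [← aeval_coords, derivation_aeval D hD]
    simp [h]
  obtain ⟨a, b, -, rfl⟩ := IsFractionRing.div_surjective (A := PolyRing) f
  exact derivation_div_eq_zero D (hpoly a) (hpoly b)

theorem derivation_ext {D D' : Derivation ℂ PhaseField PhaseField} (ht : D tt = D' tt)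
    (h : ∀ i, D (coords i) = D' (coords i)) (f : PhaseField) : D f = D' f := by
  have := derivation_eq_zero (D - D') (by simp [ht]) (fun i => by simp [h]) f
  rwa [Derivation.sub_apply, sub_eq_zero] at this

/-! ### Partial derivatives and their common constants -/

/-- The partial derivatives `∂/∂x, ∂/∂y, …` of `ℂ(t)(x, y, z, w, q, p)`. -/
def pd (i : Fin 6) : Derivation ℂ PhaseField PhaseField :=
  totalDeriv (Pi.single i 1) - totalDeriv 0

/-- The partial derivative `∂/∂t` of `ℂ(t)(x, y, z, w, q, p)`. -/
def pdt : Derivation ℂ PhaseField PhaseField := totalDeriv 0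

@[simp] theorem pd_tt (i : Fin 6) : pd i tt = 0 := by simp [pd, totalDeriv_time]

@[simp] theorem pd_coords (i j : Fin 6) : pd i (coords j) = if i = j then 1 else 0 := by
  simp [pd, totalDeriv_coords, Pi.single_apply, eq_comm]

@[simp] theorem pdt_tt : pdt tt = 1 := totalDeriv_time _

@[simp] theorem pdt_coords (j : Fin 6) : pdt (coords j) = 0 := totalDeriv_coords _ _

@[simp] theorem derivation_con (D : Derivation ℂ PhaseField PhaseField) (c : ℂ) :
    D (con c) = 0 := D.map_algebraMap c

theorem pd_algebraMap (i : Fin 6) (G : PolyRing) :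
    pd i (algebraMap PolyRing PhaseField G) = algebraMap PolyRing PhaseField (pderiv i G) := by
  rw [← aeval_coords, ← aeval_coords, derivation_aeval _ (pd_tt i)]
  simp

/-- Differentiation lowers the degree in the `i`-th variable, so a nonzero derivative cannot be a
multiple of `D`. This is applied to the denominator of a reduced fraction. -/
theorem pderiv_eq_zero_of_dvd {i : Fin 6} {D : PolyRing} (h : D ∣ pderiv i D) :
    pderiv i D = 0 := by
  by_contra h0
  obtain ⟨g, hg⟩ := h
  have hD : D ≠ 0 := by rintro rfl; simp at h0
  have hg0 : g ≠ 0 := by rintro rfl; simp at hg; exact h0 hg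
  have h1 : degreeOf i (pderiv i D) = degreeOf i D + degreeOf i g := by
    rw [hg, degreeOf_mul_eq hD hg0]
  obtain ⟨m, hm, hmi⟩ : ∃ m ∈ (pderiv i D).support, degreeOf i (pderiv i D) = m i := by
    rw [degreeOf_eq_sup]
    exact Finset.exists_mem_eq_sup _ (support_nonempty.2 h0) _
  rw [mem_support_iff, coeff_pderiv] at hm
  have h2 : m + Finsupp.single i 1 ∈ D.support := mem_support_iff.2 (left_ne_zero_of_mul hm)
  have h3 := monomial_le_degreeOf i h2
  simp at h3
  omega

theorem eq_C_of_pderiv_eq_zero {G : PolyRing} (h : ∀ i, pderiv i G = 0) : ∃ c, G = C c := by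
  refine ⟨coeff 0 G, ?_⟩
  ext m
  rw [coeff_C]
  split_ifs with hm
  · rw [hm]
  · obtain ⟨i, hi⟩ : ∃ i, m i ≠ 0 := by
      by_contra! hc
      exact hm (by ext i; simp [hc i])
    have h1 := congrArg (coeff (m - Finsupp.single i 1)) (h i)
    rw [coeff_pderiv, coeff_zero] at h1
    have h2 : m - Finsupp.single i 1 + Finsupp.single i 1 = m :=
      tsub_add_cancel_of_le (by simpa [Nat.one_le_iff_ne_zero] using hi)
    rw [h2] at h1
    exact (mul_eq_zero.1 h1).resolve_right (Nat.cast_add_one_ne_zero _)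

/-- An element of `ℂ(t)(x, y, z, w, q, p)` with vanishing partial derivatives lies in `ℂ(t)`. -/
theorem eq_algebraMap_of_pd_eq_zero {f : PhaseField} (h : ∀ i, pd i f = 0) :
    ∃ c : TimeField, f = algebraMap TimeField PhaseField c := by
  obtain ⟨n, d, hrel, hf⟩ := IsFractionRing.exists_reduced_fraction (A := PolyRing) f
  have hd0 : (d : PolyRing) ≠ 0 := nonZeroDivisors.ne_zero d.2
  have hd : algebraMap PolyRing PhaseField d ≠ 0 := by
    simp
  have hnd : algebraMap PolyRing PhaseField n = f * algebraMap PolyRing PhaseField d := by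
    rw [← hf, mul_comm]
    exact (IsLocalization.mk'_spec' PhaseField n d).symm
  -- The quotient rule for n / d with vanishing derivative; as n and d are coprime, d then divides
  -- its own derivatives.
  have key : ∀ i, (d : PolyRing) * pderiv i n = n * pderiv i (d : PolyRing) := by
    intro i
    apply IsFractionRing.injective PolyRing PhaseField
    rw [map_mul, map_mul, ← pd_algebraMap, ← pd_algebraMap, hnd, Derivation.leibniz, h]
    simp
    ring
  have hdz : ∀ i, pderiv i (d : PolyRing) = 0 := fun i =>
    pderiv_eq_zero_of_dvd (hrel.symm.dvd_of_dvd_mul_left ⟨_, (key i).symm⟩)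
  have hnz : ∀ i, pderiv i n = 0 := fun i => by
    have := key i
    rw [hdz, mul_zero] at this
    exact (mul_eq_zero.1 this).resolve_left hd0
  obtain ⟨c, hc⟩ := eq_C_of_pderiv_eq_zero hnz
  obtain ⟨e, he⟩ := eq_C_of_pderiv_eq_zero hdz
  refine ⟨c / e, ?_⟩
  rw [map_div₀, eq_div_iff, ← algebraMap_C, ← algebraMap_C, ← hc, ← he, hnd]
  rw [← algebraMap_C, ← he]
  exact hd

/-! ### Poisson brackets and canonical coordinates -/

/-- The Poisson bracket with `{x, y} = {z, w} = {q, p} = 1`. -/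
def poisson (f g : PhaseField) : PhaseField :=
  pd 0 f * pd 1 g - pd 1 f * pd 0 g + (pd 2 f * pd 3 g - pd 3 f * pd 2 g) +
    (pd 4 f * pd 5 g - pd 5 f * pd 4 g)

/-- The derivation `{·, g}`. -/
def poissonDeriv (g : PhaseField) : Derivation ℂ PhaseField PhaseField :=
  pd 1 g • pd 0 - pd 0 g • pd 1 + (pd 3 g • pd 2 - pd 2 g • pd 3) + (pd 5 g • pd 4 - pd 4 g • pd 5)

theorem poissonDeriv_apply (f g : PhaseField) : poissonDeriv g f = poisson f g := by
  simp [poissonDeriv, poisson, mul_comm]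

theorem poisson_antisymm (f g : PhaseField) : poisson f g = - poisson g f := by
  simp only [poisson]; ring

theorem poisson_add_right (f g h : PhaseField) :
    poisson f (g + h) = poisson f g + poisson f h := by
  simp only [poisson, map_add]; ring

theorem poisson_sub_right (f g h : PhaseField) :
    poisson f (g - h) = poisson f g - poisson f h := by
  simp only [poisson, map_sub]; ring

/-- Both sides are derivations, so it suffices to compare them on t and on the coordinates.
Splitting off ∂/∂t isolates the contribution of a chart that depends on time. -/
theorem hamDeriv_apply (H : PolyRing) (f : PhaseField) :
    hamDeriv H f = pdt f + poisson f (algebraMap PolyRing PhaseField H) := by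
  rw [← poissonDeriv_apply, ← Derivation.add_apply]
  refine derivation_ext ?_ ?_ f
  · simp [hamDeriv, totalDeriv_time, poissonDeriv]
  · intro i
    simp only [hamDeriv, totalDeriv_coords, Derivation.add_apply, poissonDeriv_apply, poisson,
      pd_algebraMap, pd_coords, pdt_coords]
    fin_cases i <;> simp [hamVector]

/-- The matrix of the brackets of canonical coordinates. -/
def symp : Fin 6 → Fin 6 → PhaseField :=
  ![![0, 1, 0, 0, 0, 0], ![-1, 0, 0, 0, 0, 0], ![0, 0, 0, 1, 0, 0], ![0, 0, -1, 0, 0, 0],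
    ![0, 0, 0, 0, 0, 1], ![0, 0, 0, 0, -1, 0]]

/-- Canonical coordinates of `ℂ(t)(x, y, z, w, q, p)`, whose dependence on the time is generated
by the Hamiltonian `f`. -/
structure IsCanonical (u : Fin 6 → PhaseField) (f : PhaseField) : Prop where
  poisson_eq : ∀ i j, poisson (u i) (u j) = symp i j
  pdt_eq : ∀ i, pdt (u i) = poisson (u i) f
  -- Infinitesimal substitute for invertibility of the coordinate change: what is constant along all
  -- the u_i and t is constant along the original coordinates, with no inverse to write down.
  generate : ∀ D : Derivation ℂ PhaseField PhaseField, D tt = 0 → (∀ i, D (u i) = 0) →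
    ∀ i, D (coords i) = 0

/-- The bracket with u_i is a derivation killing ℂ(t), and its values on the u_j are the standard
constants; the chain rule therefore gives Hamilton's equations in u. -/
theorem poisson_aeval {u : Fin 6 → PhaseField} (h : ∀ i j, poisson (u i) (u j) = symp i j)
    (G : PolyRing) (i : Fin 6) : poisson (u i) (aeval u G) = aeval u (hamVector G i) := by
  rw [poisson_antisymm, ← poissonDeriv_apply, derivation_aeval _ (by simp [poissonDeriv])]
  simp only [poissonDeriv_apply, h, Fin.sum_univ_six]
  fin_cases i <;> simp [symp, hamVector]

theorem pd_eq_zero_of_poissonDeriv_eq_zero {f : PhaseField}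
    (h : ∀ i, poissonDeriv f (coords i) = 0) (i : Fin 6) : pd i f = 0 := by
  simp only [poissonDeriv_apply, poisson, pd_coords] at h
  fin_cases i
  · simpa using h 1
  · simpa using h 0
  · simpa using h 3
  · simpa using h 2
  · simpa using h 5
  · simpa using h 4

/-- In canonical coordinates, the system with Hamiltonian `H` is a polynomial Hamiltonian system
if and only if `H + f` is a polynomial in these coordinates. -/
theorem isPolyHamiltonianIn_iff {u : Fin 6 → PhaseField} {f : PhaseField} (hu : IsCanonical u f)
    (H : PolyRing) : IsPolyHamiltonianIn (hamDeriv H) u ↔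
      ∃ G : PolyRing, algebraMap PolyRing PhaseField H + f = aeval u G := by
  have hD : ∀ i, hamDeriv H (u i) = poisson (u i) (algebraMap PolyRing PhaseField H + f) := by
    intro i
    rw [hamDeriv_apply, hu.pdt_eq, poisson_add_right, add_comm]
  constructor
  · rintro ⟨G, hG⟩
    -- H + f and G(u) generate the same flow on the u_i, so their difference Poisson-commutes with
    -- everything and lies in ℂ(t). This element is absorbed into G.
    have h0 : ∀ i, poissonDeriv (algebraMap PolyRing PhaseField H + f - aeval u G) (u i) = 0 := by
      intro i
      rw [poissonDeriv_apply, poisson_sub_right, ← hD, hG, poisson_aeval hu.poisson_eq, sub_self]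
    have h1 := hu.generate _ (by simp [poissonDeriv]) h0
    obtain ⟨c, hc⟩ := eq_algebraMap_of_pd_eq_zero (pd_eq_zero_of_poissonDeriv_eq_zero h1)
    refine ⟨G + C c, ?_⟩
    rw [map_add, aeval_C, ← hc]
    ring
  · rintro ⟨G, hG⟩
    exact ⟨G, fun i => by rw [hD, hG, poisson_aeval hu.poisson_eq]⟩

/-! ### The charts are canonical -/

theorem coords_ne_zero (i : Fin 6) : coords i ≠ 0 := by
  simp [coords]

theorem tt_ne_zero : tt ≠ 0 := by
  simp [tt, time, RatFunc.X_ne_zero]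

theorem con_one_eq {a : Fin 7 → ℂ}
    (ha : a 0 + a 1 + 2 * a 2 + 2 * a 3 + 2 * a 4 + a 5 + a 6 = 1) :
    con (a 0) = 1 - con (a 1) - 2 * con (a 2) - 2 * con (a 3) - 2 * con (a 4) - con (a 5)
      - con (a 6) := by
  have : a 0 = 1 - a 1 - 2 * a 2 - 2 * a 3 - 2 * a 4 - a 5 - a 6 := by linear_combination ha
  simp only [con, this, map_sub, map_mul, map_one, map_ofNat]

theorem poisson_self (f : PhaseField) : poisson f f = 0 := by
  simp only [poisson]; ring

theorem symp_antisymm (i j : Fin 6) : symp i j = - symp j i := by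
  fin_cases i <;> fin_cases j <;> simp [symp]

theorem poisson_eq_of_lt {u : Fin 6 → PhaseField}
    (h : ∀ i j, i < j → poisson (u i) (u j) = symp i j) (i j : Fin 6) :
    poisson (u i) (u j) = symp i j := by
  rcases lt_trichotomy i j with hij | rfl | hij
  · exact h i j hij
  · rw [poisson_self]; fin_cases i <;> simp [symp]
  · rw [poisson_antisymm, h j i hij, ← symp_antisymm]

theorem forall_lt_six {p : Fin 6 → Fin 6 → Prop} (h01 : p 0 1) (h02 : p 0 2) (h03 : p 0 3)
    (h04 : p 0 4) (h05 : p 0 5) (h12 : p 1 2) (h13 : p 1 3) (h14 : p 1 4) (h15 : p 1 5)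
    (h23 : p 2 3) (h24 : p 2 4) (h25 : p 2 5) (h34 : p 3 4) (h35 : p 3 5) (h45 : p 4 5)
    (i j : Fin 6) (h : i < j) : p i j := by
  fin_cases i <;> fin_cases j <;> first | assumption | (exact absurd h (by decide))

theorem derivation_eq_zero_of_inv {D : Derivation ℂ PhaseField PhaseField} {b : PhaseField}
    (hb : b ≠ 0) (h : D (1 / b) = 0) : D b = 0 := by
  have h1 : D (b * (1 / b)) = 0 := by
    rw [mul_one_div_cancel hb, Derivation.map_one_eq_zero]
  rw [Derivation.leibniz, h, smul_zero, zero_add, smul_eq_mul] at h1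
  exact (mul_eq_zero.1 h1).resolve_left (by simpa using hb)

theorem derivation_eq_zero_of_mul {D : Derivation ℂ PhaseField PhaseField} {b c : PhaseField}
    (hb : b ≠ 0) (hb0 : D b = 0) (h : D (c * b) = 0) : D c = 0 := by
  rw [Derivation.leibniz, hb0, smul_zero, zero_add, smul_eq_mul] at h
  exact (mul_eq_zero.1 h).resolve_left hb

theorem derivation_eq_zero_of_chart {D : Derivation ℂ PhaseField PhaseField} {b c e : PhaseField}
    (hb : b ≠ 0) (hb0 : D b = 0) (he : D e = 0) (h : D (-(c * b + e) * b) = 0) : D c = 0 := by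
  have h1 := derivation_eq_zero_of_mul hb hb0 h
  rw [map_neg, neg_eq_zero, map_add, he, add_zero] at h1
  exact derivation_eq_zero_of_mul hb hb0 h1

/-- This element is w_3, the denominator of w_4; its derivative in w is -z², which is nonzero. -/
theorem chart34_pole_ne_zero (α : ℂ) : -(coords 3 * coords 2 + con α) * coords 2 ≠ 0 := by
  intro h
  have h2 := congrArg (fun f => pd 3 f) h
  simp [coords_ne_zero] at h2

theorem isCanonical_r0 (a : Fin 7 → ℂ) : IsCanonical (r0 a coords) 0 where
  poisson_eq := by
    have hb := coords_ne_zero 0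
    apply poisson_eq_of_lt
    apply forall_lt_six <;>
      (simp [poisson, r0, symp, Derivation.leibniz,
          Derivation.leibniz_inv]; try field_simp; try ring)
  pdt_eq i := by
    fin_cases i <;> simp [poisson, r0, Derivation.leibniz, Derivation.leibniz_inv]
  generate D ht h := by
    have hx := derivation_eq_zero_of_inv (coords_ne_zero 0) (h 0)
    have hy := derivation_eq_zero_of_chart (coords_ne_zero 0) hx (derivation_con D _) (h 1)
    rw [map_sub, Derivation.map_one_eq_zero, sub_zero] at hy
    exact fun i => by fin_cases i <;> first | assumption | exact h 2 | exact h 3 | exact h 4 | exact h 5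

theorem isCanonical_r1 (a : Fin 7 → ℂ) : IsCanonical (r1 a coords) 0 where
  poisson_eq := by
    have hb := coords_ne_zero 0
    apply poisson_eq_of_lt
    apply forall_lt_six <;>
      (simp [poisson, r1, symp, Derivation.leibniz,
          Derivation.leibniz_inv]; try field_simp; try ring)
  pdt_eq i := by
    fin_cases i <;> simp [poisson, r1, Derivation.leibniz, Derivation.leibniz_inv]
  generate D ht h := by
    have hx := derivation_eq_zero_of_inv (coords_ne_zero 0) (h 0)
    have hy := derivation_eq_zero_of_chart (coords_ne_zero 0) hx (derivation_con D _) (h 1)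
    exact fun i => by fin_cases i <;> first | assumption | exact h 2 | exact h 3 | exact h 4 | exact h 5

theorem isCanonical_r2 (a : Fin 7 → ℂ) : IsCanonical (r2 a coords) 0 where
  poisson_eq := by
    have hb := coords_ne_zero 1
    apply poisson_eq_of_lt
    apply forall_lt_six <;>
      (simp [poisson, r2, symp, Derivation.leibniz,
          Derivation.leibniz_inv]; try field_simp; try ring)
  pdt_eq i := by
    fin_cases i <;> simp [poisson, r2, Derivation.leibniz, Derivation.leibniz_inv]
  generate D ht h := by
    have hy := derivation_eq_zero_of_inv (coords_ne_zero 1) (h 1)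
    have hx := derivation_eq_zero_of_chart (coords_ne_zero 1) hy (e := -con (a 2)) (by simp) (h 0)
    have hz : D (coords 2) = 0 := h 2
    rw [map_sub, hz, sub_zero] at hx
    have hw : D (coords 3 + coords 1) = 0 := h 3
    rw [map_add, hy, add_zero] at hw
    exact fun i => by fin_cases i <;> first | assumption | exact h 4 | exact h 5

theorem isCanonical_r3 (a : Fin 7 → ℂ) : IsCanonical (r3 a coords) 0 where
  poisson_eq := by
    have hb := coords_ne_zero 2
    apply poisson_eq_of_lt
    apply forall_lt_six <;>
      (simp [poisson, r3, symp, Derivation.leibniz,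
          Derivation.leibniz_inv]; try field_simp; try ring)
  pdt_eq i := by
    fin_cases i <;> simp [poisson, r3, Derivation.leibniz, Derivation.leibniz_inv]
  generate D ht h := by
    have hz := derivation_eq_zero_of_inv (coords_ne_zero 2) (h 2)
    have hw := derivation_eq_zero_of_chart (coords_ne_zero 2) hz (derivation_con D _) (h 3)
    exact fun i => by fin_cases i <;> first | assumption | exact h 0 | exact h 1 | exact h 4 | exact h 5

theorem isCanonical_r5 (a : Fin 7 → ℂ) : IsCanonical (r5 a coords) 0 where
  poisson_eq := by
    have hb := coords_ne_zero 4
    apply poisson_eq_of_lt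
    apply forall_lt_six <;>
      (simp [poisson, r5, symp, Derivation.leibniz,
          Derivation.leibniz_inv]; try field_simp; try ring)
  pdt_eq i := by
    fin_cases i <;> simp [poisson, r5, Derivation.leibniz, Derivation.leibniz_inv]
  generate D ht h := by
    have hq := derivation_eq_zero_of_inv (coords_ne_zero 4) (h 4)
    have hp := derivation_eq_zero_of_chart (coords_ne_zero 4) hq (derivation_con D _) (h 5)
    exact fun i => by fin_cases i <;> first | assumption | exact h 0 | exact h 1 | exact h 2 | exact h 3

/-- The only chart in which t occurs: ∂p_6/∂t = q² = {p_6, q}, while q_6 is independent of t and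
commutes with q. Hence the correction term is q. -/
theorem isCanonical_r6 (a : Fin 7 → ℂ) : IsCanonical (r6 a coords) (coords 4) where
  poisson_eq := by
    have hb := coords_ne_zero 4
    apply poisson_eq_of_lt
    apply forall_lt_six <;>
      (simp [poisson, r6, symp, Derivation.leibniz,
          Derivation.leibniz_inv]; try field_simp; try ring)
  pdt_eq i := by
    fin_cases i <;> simp [poisson, r6, Derivation.leibniz, Derivation.leibniz_inv]
  generate D ht h := by
    have hq := derivation_eq_zero_of_inv (coords_ne_zero 4) (h 4)
    have hp := derivation_eq_zero_of_chart (coords_ne_zero 4) hq (derivation_con D _) (h 5)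
    rw [map_sub, ht, sub_zero] at hp
    exact fun i => by fin_cases i <;> first | assumption | exact h 0 | exact h 1 | exact h 2 | exact h 3

set_option maxHeartbeats 800000 in
theorem isCanonical_r4_r3 (a : Fin 7 → ℂ) : IsCanonical (r4 a (r3 a coords)) 0 where
  poisson_eq := by
    have hb := coords_ne_zero 2
    have hs := chart34_pole_ne_zero (a 3)
    have hs' := left_ne_zero_of_mul hs
    have hs'' : -con (a 3) + -(coords 2 * coords 3) ≠ 0 := by
      rwa [neg_add_rev, mul_comm (coords 3)] at hs'
    rw [neg_ne_zero] at hs'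
    apply poisson_eq_of_lt
    apply forall_lt_six <;>
      (simp [poisson, r4, r3, symp, Derivation.leibniz,
          Derivation.leibniz_inv]; try field_simp; try ring)
  pdt_eq i := by
    fin_cases i <;> simp [poisson, r4, r3, Derivation.leibniz, Derivation.leibniz_inv]
  generate D ht h := by
    have hs := derivation_eq_zero_of_inv (chart34_pole_ne_zero (a 3)) (h 3)
    have hz : D (1 / coords 2 - coords 4) = 0 :=
      derivation_eq_zero_of_chart (chart34_pole_ne_zero (a 3)) hs (e := -con (a 4)) (by simp) (h 2)
    have hq : D (coords 4) = 0 := h 4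
    rw [map_sub, hq, sub_zero] at hz
    replace hz := derivation_eq_zero_of_inv (coords_ne_zero 2) hz
    have hw := derivation_eq_zero_of_chart (coords_ne_zero 2) hz (derivation_con D _) hs
    have hp : D (coords 5 + -(coords 3 * coords 2 + con (a 3)) * coords 2) = 0 := h 5
    rw [map_add, hs, add_zero] at hp
    exact fun i => by fin_cases i <;> first | assumption | exact h 0 | exact h 1

/-! ### The Hamiltonian of type D_6 is polynomial in every chart -/

theorem aeval_C_time (u : Fin 6 → PhaseField) : aeval u (C time : PolyRing) = tt := by
  rw [aeval_C]; rfl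

theorem aeval_C_time_inv (u : Fin 6 → PhaseField) : aeval u (C time⁻¹ : PolyRing) = tt⁻¹ := by
  rw [aeval_C, map_inv₀]; rfl

theorem aeval_algebraMap_complex (u : Fin 6 → PhaseField) (c : ℂ) :
    aeval u (algebraMap ℂ PolyRing c) = con c := by
  rw [IsScalarTower.algebraMap_apply ℂ TimeField PolyRing, MvPolynomial.algebraMap_eq, aeval_C,
    ← IsScalarTower.algebraMap_apply]
  rfl

theorem algebraMap_hamD6 (a : Fin 7 → ℂ) : algebraMap PolyRing PhaseField (hamD6 a) =
    tt⁻¹ * ((coords 0 ^ 2 * (coords 1 - 1) * coords 1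
        + coords 0 * ((con (a 0) + con (a 1)) * coords 1 - con (a 1)) + tt * coords 1)
      + (coords 2 ^ 2 * (coords 3 - 1) * coords 3 + coords 2 * ((con (a 0) + con (a 1)
        + 2 * con (a 2) + 2 * con (a 3)) * coords 3 - con (a 3)) + tt * coords 3)
      + (coords 4 ^ 2 * (coords 5 - tt) * coords 5
        + coords 4 * ((con (a 5) + con (a 6) - 1) * coords 5 - tt * con (a 5)) + coords 5)
      + 2 * coords 1 * coords 2 * (coords 2 * coords 3 + con (a 3))
      - 2 * (coords 1 + coords 3) * coords 5) := by
  rw [← aeval_coords]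
  simp only [hamD6, map_mul, map_add, map_sub, map_pow, map_one, map_ofNat, aeval_X, aeval_C_time,
    aeval_C_time_inv, aeval_algebraMap_complex]

@[simp] theorem algebraMap_time : algebraMap TimeField PhaseField time = tt := rfl

/-- The part of `t H_{D₆}` that depends on `(x, y)` only. -/
def partXY (α β x y : PolyRing) : PolyRing :=
  x ^ 2 * (y - 1) * y + x * ((α + β) * y - β)

/-- The part of `t H_{D₆}` that depends on `(z, w)` and `y`. -/
def partZW (A α y z w : PolyRing) : PolyRing :=
  z ^ 2 * (w - 1) * w + z * (A * w - α) + 2 * y * z * (z * w + α)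

/-- The part of `t H_{D₆}` that depends on `(q, p)` only. -/
def partQP (α β t q p : PolyRing) : PolyRing :=
  q ^ 2 * (p - t) * p + q * ((α + β - 1) * p - t * α)

/-- The part of `t H_{D₆}` that is linear in `y + w` and in `p`. -/
def partLin (t W p : PolyRing) : PolyRing := t * W + p - 2 * W * p

theorem chart_hamD6_of_eq {a : Fin 7 → ℂ} {c : TimeField} {u : Fin 6 → PhaseField} {f : PhaseField}
    (hu : IsCanonical u f) {G : PolyRing}
    (h : algebraMap PolyRing PhaseField (hamD6 a) + f = aeval u (C time⁻¹ * G)) :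
    IsPolyHamiltonianIn (hamDeriv (hamD6 a + C c)) u := by
  refine (isPolyHamiltonianIn_iff hu _).2 ⟨C time⁻¹ * G + C c, ?_⟩
  rw [map_add, map_add, ← h, aeval_C, algebraMap_C]
  ring

/-- A parameter as a constant polynomial. -/
def par (c : ℂ) : PolyRing := algebraMap ℂ PolyRing c

@[simp] theorem aeval_par (u : Fin 6 → PhaseField) (c : ℂ) : aeval u (par c) = con c :=
  aeval_algebraMap_complex u c

theorem chart0_hamD6 (a : Fin 7 → ℂ) (c : TimeField) :
    IsPolyHamiltonianIn (hamDeriv (hamD6 a + C c)) (r0 a coords) := by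
  refine chart_hamD6_of_eq (isCanonical_r0 a)
    (G :=
      -- In the old coordinates s = (y - 1)x. The xy-part of t H_{D_6}, without ty, is s² + (α_0 +
      -- α_1)s + x(s + α_0), and x(s + α_0) = -y_0. The charts r_1, r_3, r_5, r_6 use the analogous
      -- s.
      let s := -(X 1 * X 0 + par (a 0))
      let y := 1 + s * X 0
      s ^ 2 + (par (a 0) + par (a 1)) * s - X 1 + partZW (par (a 0) + par (a 1) + 2 * par (a 2)
          + 2 * par (a 3)) (par (a 3)) y (X 2) (X 3)
        + partQP (par (a 5)) (par (a 6)) (C time) (X 4) (X 5) + partLin (C time) (y + X 3) (X 5)) ?_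
  have ht := tt_ne_zero
  have hb := coords_ne_zero 0
  rw [algebraMap_hamD6]
  simp [-mul_eq_mul_left_iff, partZW, partQP, partLin, r0]
  field_simp
  ring

theorem chart1_hamD6 (a : Fin 7 → ℂ) (c : TimeField) :
    IsPolyHamiltonianIn (hamDeriv (hamD6 a + C c)) (r1 a coords) := by
  refine chart_hamD6_of_eq (isCanonical_r1 a)
    (G :=
      let s := -(X 1 * X 0 + par (a 1))
      let y := s * X 0
      s ^ 2 + (par (a 0) + par (a 1)) * s + X 1 + partZW (par (a 0) + par (a 1) + 2 * par (a 2)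
          + 2 * par (a 3)) (par (a 3)) y (X 2) (X 3)
        + partQP (par (a 5)) (par (a 6)) (C time) (X 4) (X 5) + partLin (C time) (y + X 3) (X 5)) ?_
  have ht := tt_ne_zero
  have hb := coords_ne_zero 0
  rw [algebraMap_hamD6]
  simp [-mul_eq_mul_left_iff, partZW, partQP, partLin, r1]
  field_simp
  ring

theorem chart2_hamD6 (a : Fin 7 → ℂ) (c : TimeField) :
    IsPolyHamiltonianIn (hamDeriv (hamD6 a + C c)) (r2 a coords) := by
  refine chart_hamD6_of_eq (isCanonical_r2 a)
    (G :=
      -- m is (x - z)y, so that x = z + m y_2.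
      let m := par (a 2) - X 0 * X 1
      m ^ 2 - 2 * X 2 * m - m ^ 2 * X 1 + (par (a 0) + par (a 1)) * m
        - par (a 1) * (X 2 + m * X 1) + X 2 ^ 2 * X 3 ^ 2 - X 2 ^ 2 * X 3
        + X 2 * ((par (a 0) + par (a 1) + 2 * par (a 2) + 2 * par (a 3)) * X 3 - par (a 3))
        - 2 * X 2 * X 0 + partQP (par (a 5)) (par (a 6)) (C time) (X 4) (X 5)
        + partLin (C time) (X 3) (X 5)) ?_
  have ht := tt_ne_zero
  have hb := coords_ne_zero 1
  rw [algebraMap_hamD6]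
  simp [-mul_eq_mul_left_iff, partQP, partLin, r2]
  field_simp
  ring

theorem chart3_hamD6 (a : Fin 7 → ℂ) (c : TimeField) :
    IsPolyHamiltonianIn (hamDeriv (hamD6 a + C c)) (r3 a coords) := by
  refine chart_hamD6_of_eq (isCanonical_r3 a)
    (G :=
      let s := -(X 3 * X 2 + par (a 3))
      partXY (par (a 0)) (par (a 1)) (X 0) (X 1) + s ^ 2 + (par (a 0) + par (a 1)
          + 2 * par (a 2) + 2 * par (a 3)) * s
        + X 3 - 2 * X 1 * X 3 + partQP (par (a 5)) (par (a 6)) (C time) (X 4) (X 5)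
          + partLin (C time) (X 1 + s * X 2) (X 5)) ?_
  have ht := tt_ne_zero
  have hb := coords_ne_zero 2
  rw [algebraMap_hamD6]
  simp [-mul_eq_mul_left_iff, partXY, partQP, partLin, r3]
  field_simp
  ring

theorem chart5_hamD6 (a : Fin 7 → ℂ) (c : TimeField) :
    IsPolyHamiltonianIn (hamDeriv (hamD6 a + C c)) (r5 a coords) := by
  refine chart_hamD6_of_eq (isCanonical_r5 a)
    (G :=
      let s := -(X 5 * X 4 + par (a 5))
      partXY (par (a 0)) (par (a 1)) (X 0) (X 1) + partZW (par (a 0) + par (a 1) + 2 * par (a 2)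
          + 2 * par (a 3)) (par (a 3)) (X 1) (X 2) (X 3)
        + s ^ 2 + (par (a 5) + par (a 6) - 1) * s + C time * X 5 + partLin (C time)
          (X 1 + X 3) (s * X 4)) ?_
  have ht := tt_ne_zero
  have hb := coords_ne_zero 4
  rw [algebraMap_hamD6]
  simp [-mul_eq_mul_left_iff, partXY, partZW, partLin, r5]
  field_simp
  ring

theorem chart6_hamD6 (a : Fin 7 → ℂ) (c : TimeField) :
    IsPolyHamiltonianIn (hamDeriv (hamD6 a + C c)) (r6 a coords) := by
  refine chart_hamD6_of_eq (isCanonical_r6 a)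
    (G :=
      let s := -(X 5 * X 4 + par (a 6))
      partXY (par (a 0)) (par (a 1)) (X 0) (X 1) + partZW (par (a 0) + par (a 1) + 2 * par (a 2)
          + 2 * par (a 3)) (par (a 3)) (X 1) (X 2) (X 3)
        + s ^ 2 + (par (a 5) + par (a 6) - 1) * s - C time * X 5 + partLin (C time)
          (X 1 + X 3) (C time + s * X 4)) ?_
  have ht := tt_ne_zero
  have hb := coords_ne_zero 4
  rw [algebraMap_hamD6]
  simp [-mul_eq_mul_left_iff, partXY, partZW, partLin, r6]
  field_simp
  ring

theorem chart34_hamD6 (a : Fin 7 → ℂ)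
    (ha : a 0 + a 1 + 2 * a 2 + 2 * a 3 + 2 * a 4 + a 5 + a 6 = 1) (c : TimeField) :
    IsPolyHamiltonianIn (hamDeriv (hamD6 a + C c)) (r4 a (r3 a coords)) := by
  refine chart_hamD6_of_eq (isCanonical_r4_r3 a)
    (G :=
      -- m is (z_3 - q)w_3, so that z_3 = q + m w_4 and zw = -(q w_3 + m + α_3).
      let m := par (a 4) - X 2 * X 3
      partXY (par (a 0)) (par (a 1)) (X 0) (X 1) + C time * X 1 - 2 * X 1 * X 5 + (m
          + par (a 3)) ^ 2
        - (par (a 0) + par (a 1) + 2 * par (a 2) + 2 * par (a 3)) * (m + par (a 3))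
        - C time * (X 4 * m + (m + par (a 3)) * X 4 + (m + par (a 3)) * m * X 3)
        + 2 * X 5 * (X 4 * m + (m + par (a 3)) * X 4 + (m + par (a 3)) * m * X 3)
        - 2 * (m + par (a 3)) * m + X 4 ^ 2 * X 5 * (X 5 - C time)
        + (par (a 5) + par (a 6) - 1) * X 4 * X 5 - C time * par (a 5) * X 4 + X 5
        + 2 * X 4 * X 2) ?_
  have ht := tt_ne_zero
  have hb := coords_ne_zero 2
  have hs := left_ne_zero_of_mul (chart34_pole_ne_zero (a 3))
  have hs' : -con (a 3) + -(coords 2 * coords 3) ≠ 0 := by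
    rwa [neg_add_rev, mul_comm (coords 3)] at hs
  rw [neg_ne_zero] at hs
  rw [algebraMap_hamD6]
  -- After all other cancellations the polar part of t H_{D_6} is q / w_4 times 1 minus the weighted
  -- sum of the parameters; eliminating α_0 removes it.
  simp [-mul_eq_mul_left_iff, partXY, r4, r3, con_one_eq ha]
  field_simp
  ring

/-! ### Pole conditions as equations between coefficients -/

/-- A polynomial in coordinates one of which is `1 / s`, the others being polynomials, may be
evaluated at every point where `s` does not vanish. -/
theorem aeval_eq_of_chart {B : Type*} [Field B] [Algebra TimeField B] {s : PolyRing} (hs : s ≠ 0)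
    {N : Fin 6 → PolyRing} {a : Fin 6} {u : Fin 6 → PhaseField}
    (hua : u a = 1 / algebraMap PolyRing PhaseField s)
    (hu : ∀ i, i ≠ a → u i = algebraMap PolyRing PhaseField (N i)) {K G : PolyRing}
    (h : algebraMap PolyRing PhaseField K = aeval u G) {v : Fin 6 → B} (hv : aeval v s ≠ 0)
    {u' : Fin 6 → B} (hua' : u' a = 1 / aeval v s) (hu' : ∀ i, i ≠ a → u' i = aeval v (N i)) :
    aeval v K = aeval u' G := by
  have hs' : algebraMap PolyRing PhaseField s ≠ 0 := by simpa using hs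
  -- A power of s clears all denominators in G(u). The resulting identity s^n K = P between
  -- polynomials survives every evaluation.
  obtain ⟨n, P, hP, hPv⟩ : ∃ (n : ℕ) (P : PolyRing),
      algebraMap PolyRing PhaseField P = algebraMap PolyRing PhaseField s ^ n * aeval u G ∧
      aeval v P = aeval v s ^ n * aeval u' G := by
    clear h
    induction G using MvPolynomial.induction_on with
    | C r => exact ⟨0, C r, by simp [algebraMap_C], by simp⟩
    | add f g hf hg =>
      obtain ⟨n, P, hP, hPv⟩ := hf
      obtain ⟨m, Q, hQ, hQv⟩ := hg
      refine ⟨n + m, s ^ m * P + s ^ n * Q, ?_, ?_⟩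
      · rw [map_add, map_mul, map_mul, map_pow, map_pow, hP, hQ, map_add]; ring
      · rw [map_add, map_mul, map_mul, map_pow, map_pow, hPv, hQv, map_add]; ring
    | mul_X f i hf =>
      obtain ⟨n, P, hP, hPv⟩ := hf
      by_cases hi : i = a
      · refine ⟨n + 1, P, ?_, ?_⟩
        · rw [map_mul, aeval_X, hi, hua, hP]; field_simp; ring
        · rw [map_mul, aeval_X, hi, hua', hPv]; field_simp; ring
      · refine ⟨n, P * N i, ?_, ?_⟩
        · rw [map_mul, map_mul, aeval_X, hu i hi, hP]; ring
        · rw [map_mul, map_mul, aeval_X, hu' i hi, hPv]; ring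
  have hK : P = s ^ n * K := by
    apply IsFractionRing.injective PolyRing PhaseField
    rw [hP, map_mul, map_pow, h]
  rw [hK, map_mul, map_pow] at hPv
  exact mul_left_cancel₀ (pow_ne_zero n hv) hPv

theorem coeff_monomial_mul_aeval_X {a : Fin 6} {r r' : Fin 6 →₀ ℕ} (hr : r a = 0) (hr' : r' a = 0)
    (n : ℕ) (f : Polynomial TimeField) :
    coeff (r + Finsupp.single a n) (monomial r' 1 * Polynomial.aeval (X a : PolyRing) f) =
      if r' = r then f.coeff n else 0 := by
  induction f using Polynomial.induction_on' with
  | add f g hf hg =>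
    rw [map_add, mul_add, coeff_add, hf, hg, Polynomial.coeff_add]
    split_ifs <;> simp
  | monomial k c =>
    have h1 : Polynomial.aeval (X a : PolyRing) (Polynomial.monomial k c) =
        monomial (Finsupp.single a k) c := by
      rw [Polynomial.aeval_monomial, ← C_mul_X_pow_eq_monomial]; rfl
    have h2 : r' + Finsupp.single a k = r + Finsupp.single a n ↔ r' = r ∧ k = n := by
      constructor
      · intro h
        have hk : k = n := by
          have := DFunLike.congr_fun h a
          simpa [hr, hr'] using this
        subst hk
        exact ⟨add_right_cancel h, rfl⟩
      · rintro ⟨rfl, rfl⟩; rfl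
    rw [h1, monomial_mul, coeff_monomial, Polynomial.coeff_monomial, one_mul]
    simp only [h2]
    by_cases hrr : r' = r <;> by_cases hk : k = n <;> simp [hrr, hk]

/-- The contribution of `x ^ i * y ^ j` to `ξ ^ 4 K(1 / ξ, τ - α ξ)`. -/
def poleFactor (τ α : TimeField) (i j : ℕ) : Polynomial TimeField :=
  Polynomial.X ^ (4 - i) * (Polynomial.C τ - Polynomial.C α * Polynomial.X) ^ j

theorem apply_le_totalDegree {K : PolyRing} {m : Fin 6 →₀ ℕ} (hm : m ∈ K.support) (i : Fin 6) :
    m i ≤ K.totalDegree :=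
  (monomial_le_degreeOf i hm).trans (degreeOf_le_totalDegree K i)

theorem sum_eq_add_single {a b : Fin 6} (hab : a ≠ b) (m : Fin 6 →₀ ℕ) :
    (m.erase a).erase b + Finsupp.single a (m a) + Finsupp.single b (m b) = m := by
  ext i
  by_cases hb : i = b
  · subst hb; simp [hab]
  · by_cases ha : i = a
    · subst ha; simp [hb]
    · simp [ha, hb]

/-- The factor ξ^4 is enough because K has degree at most 4 in the variable replaced by 1 / ξ. The
letter `coords a` now plays the role of ξ. -/
theorem X_pow_mul_eq_sum {K : PolyRing} (hK : K.totalDegree ≤ 4) {a b : Fin 6} (hab : a ≠ b)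
    (τ α : TimeField) {v : Fin 6 → PhaseField} (hva : v a = 1 / coords a)
    (hvb : v b = algebraMap TimeField PhaseField τ - algebraMap TimeField PhaseField α * coords a)
    (hv : ∀ i, i ≠ a → i ≠ b → v i = coords i) :
    coords a ^ 4 * aeval v K = algebraMap PolyRing PhaseField (∑ m ∈ K.support,
      C (coeff m K) * (monomial ((m.erase a).erase b) 1 *
        Polynomial.aeval (X a : PolyRing) (poleFactor τ α (m a) (m b)))) := by
  conv_lhs => rw [K.as_sum]
  rw [map_sum, map_sum, Finset.mul_sum]
  refine Finset.sum_congr rfl fun m hm => ?_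
  have h4 : m a ≤ 4 := (apply_le_totalDegree hm a).trans hK
  have hx := coords_ne_zero a
  have h1 : ∀ m' : Fin 6 →₀ ℕ, m' a = 0 → m' b = 0 →
      aeval v (monomial m' (1 : TimeField)) = algebraMap PolyRing PhaseField (monomial m' 1) := by
    intro m' ha hb
    rw [← aeval_coords, aeval_monomial, aeval_monomial, Finsupp.prod, Finsupp.prod]
    congr 1
    refine Finset.prod_congr rfl fun i hi => ?_
    rw [hv i]
    · rintro rfl; simp [ha] at hi
    · rintro rfl; simp [hb] at hi
  have h2 : monomial m (coeff m K) = C (coeff m K) * (monomial ((m.erase a).erase b) 1 *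
      (X a ^ m a * X b ^ m b)) := by
    rw [X_pow_eq_monomial, X_pow_eq_monomial, monomial_mul, monomial_mul, C_mul_monomial]
    simp [← add_assoc, sum_eq_add_single hab]
  rw [h2]
  simp only [map_mul, map_pow, aeval_X, aeval_C, hva, hvb, algebraMap_C]
  rw [h1 _ (by simp [hab]) (by simp)]
  have h3 : algebraMap PolyRing PhaseField
      (Polynomial.aeval (X a : PolyRing) (poleFactor τ α (m a) (m b))) =
      coords a ^ (4 - m a) * (algebraMap TimeField PhaseField τ -
        algebraMap TimeField PhaseField α * coords a) ^ m b := by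
    simp [poleFactor, coords, MvPolynomial.algebraMap_eq, algebraMap_C]
  rw [h3]
  have h5 : coords a ^ 4 * (1 / coords a) ^ m a = coords a ^ (4 - m a) := by
    rw [one_div, inv_pow, pow_sub₀ _ hx h4]
  rw [← h5]
  ring

/-- If `K(1 / ξ, τ - α ξ)` has no pole at `ξ = 0`, then neither have its coefficients with respect
to the other variables. -/
theorem sum_poleFactor_eq_zero {K : PolyRing} (hK : K.totalDegree ≤ 4) {a b : Fin 6} (hab : a ≠ b)
    {τ α : TimeField} {v : Fin 6 → PhaseField} (hva : v a = 1 / coords a)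
    (hvb : v b = algebraMap TimeField PhaseField τ - algebraMap TimeField PhaseField α * coords a)
    (hv : ∀ i, i ≠ a → i ≠ b → v i = coords i) {G : PolyRing}
    (hG : aeval v K = algebraMap PolyRing PhaseField G) {r : Fin 6 →₀ ℕ} (hra : r a = 0)
    (hrb : r b = 0) {n : ℕ} (hn : n < 4) :
    ∑ i ∈ Finset.range 5, ∑ j ∈ Finset.range 5,
      coeff (r + Finsupp.single a i + Finsupp.single b j) K * (poleFactor τ α i j).coeff n = 0 := by
  have h0 := X_pow_mul_eq_sum hK hab τ α hva hvb hv
  rw [hG, coords, ← map_pow, ← map_mul] at h0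
  -- One side is divisible by ξ^4, so its coefficient at ξ^n with n < 4 is zero.
  have h1 := congrArg (coeff (r + Finsupp.single a n)) (IsFractionRing.injective _ _ h0)
  rw [X_pow_eq_monomial, coeff_monomial_mul', if_neg, coeff_sum] at h1
  swap
  · intro h
    have := h a
    simp [hra] at this
    omega
  simp only [coeff_C_mul] at h1
  rw [Finset.sum_congr rfl fun m _ => by
    rw [coeff_monomial_mul_aeval_X hra (by simp [hab])]] at h1
  rw [← Finset.sum_product', h1]
  let φ : ℕ × ℕ → (Fin 6 →₀ ℕ) := fun p => r + Finsupp.single a p.1 + Finsupp.single b p.2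
  have hφa : ∀ p, φ p a = p.1 := fun p => by simp [φ, hra, hab]
  have hφb : ∀ p, φ p b = p.2 := fun p => by simp [φ, hrb, hab.symm]
  have hφr : ∀ p, ((φ p).erase a).erase b = r := fun p => by
    ext i
    by_cases hb : i = b
    · subst hb; simp [hrb]
    · by_cases ha : i = a
      · subst ha; simp [hb, hra]
      · simp [φ, ha, hb]
  have hinj : Function.Injective φ := fun p q h => by
    rw [Prod.ext_iff, ← hφa p, ← hφb p, h, hφa, hφb]
    exact ⟨rfl, rfl⟩
  classical
  -- Both index sets are enlarged to their union: a monomial of the support with the remaining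
  -- exponents r has its exponents at `a` and `b` at most 4, and outside the support the coefficient
  -- is zero.
  calc _ = ∑ m ∈ (Finset.range 5 ×ˢ Finset.range 5).image φ, coeff m K *
        (if (m.erase a).erase b = r then (poleFactor τ α (m a) (m b)).coeff n else 0) := by
        rw [Finset.sum_image fun p _ q _ h => hinj h]
        refine Finset.sum_congr rfl fun p _ => ?_
        rw [if_pos (hφr p), hφa, hφb]
    _ = ∑ m ∈ K.support ∪ (Finset.range 5 ×ˢ Finset.range 5).image φ, coeff m K *
        (if (m.erase a).erase b = r then (poleFactor τ α (m a) (m b)).coeff n else 0) := by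
        refine Finset.sum_subset Finset.subset_union_right fun m hm hm' => ?_
        have hms := (Finset.mem_union.1 hm).resolve_right hm'
        rw [if_neg, mul_zero]
        rintro rfl
        refine hm' (Finset.mem_image.2 ⟨(m a, m b), ?_, sum_eq_add_single hab m⟩)
        have ha := (apply_le_totalDegree hms a).trans hK
        have hb := (apply_le_totalDegree hms b).trans hK
        simp only [Finset.mem_product, Finset.mem_range]
        omega
    _ = _ := by
        refine (Finset.sum_subset Finset.subset_union_left fun m _ hm => ?_).symm
        rw [notMem_support_iff.1 hm, zero_mul]

/-- The coefficients of ξ^(-4), ..., ξ^(-1) in Σ d_ij ξ^(-i) (τ - αξ)^j. The degree bound truncates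
each of them, so that α enters at most linearly. -/
theorem pole_equations {d : ℕ → ℕ → TimeField} {τ α : TimeField}
    (hd : ∀ i j, 4 < i + j → d i j = 0)
    (h : ∀ n < 4, ∑ i ∈ Finset.range 5, ∑ j ∈ Finset.range 5,
      d i j * (poleFactor τ α i j).coeff n = 0) :
    d 4 0 = 0 ∧ d 3 0 + d 3 1 * τ = 0 ∧
      d 2 0 + d 2 1 * τ + d 2 2 * τ ^ 2 - α * d 3 1 = 0 ∧
      d 1 0 + d 1 1 * τ + d 1 2 * τ ^ 2 + d 1 3 * τ ^ 3 - α * (d 2 1 + 2 * τ * d 2 2) = 0 := by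
  have h2 : (Polynomial.C τ - Polynomial.C α * Polynomial.X) ^ 2 = Polynomial.C (τ ^ 2) -
      Polynomial.C (2 * τ * α) * Polynomial.X + Polynomial.C (α ^ 2) * Polynomial.X ^ 2 := by
    simp only [map_mul, map_pow, map_ofNat]; ring
  have c20 : ((Polynomial.C τ - Polynomial.C α * Polynomial.X) ^ 2).coeff 0 = τ ^ 2 := by
    simp [Polynomial.coeff_zero_eq_eval_zero]
  have c30 : ((Polynomial.C τ - Polynomial.C α * Polynomial.X) ^ 3).coeff 0 = τ ^ 3 := by
    simp [Polynomial.coeff_zero_eq_eval_zero]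
  have c21 : ((Polynomial.C τ - Polynomial.C α * Polynomial.X) ^ 2).coeff 1 = -(2 * τ * α) := by
    rw [h2]
    simp [-map_pow, -map_mul, Polynomial.coeff_X_pow, Polynomial.coeff_C]
  have e0 := h 0 (by norm_num)
  have e1 := h 1 (by norm_num)
  have e2 := h 2 (by norm_num)
  have e3 := h 3 (by norm_num)
  simp [Finset.sum_range_succ, hd, poleFactor, Polynomial.coeff_X_pow_mul', c20, c30, c21,
    Polynomial.coeff_one, Polynomial.coeff_X, Polynomial.coeff_C] at e0 e1 e2 e3
  refine ⟨e0, ?_, ?_, ?_⟩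
  · linear_combination e1
  · linear_combination e2
  · linear_combination e3

/-- The coefficient of `x ^ i * y ^ j * z ^ k * w ^ l * q ^ m * p ^ n`. -/
def cf (K : PolyRing) (i j k l m n : ℕ) : TimeField :=
  coeff (Finsupp.equivFunOnFinite.symm ![i, j, k, l, m, n]) K

theorem cf_eq_zero {K : PolyRing} (hK : K.totalDegree ≤ 4) {i j k l m n : ℕ}
    (h : 4 < i + j + k + l + m + n) : cf K i j k l m n = 0 := by
  apply coeff_eq_zero_of_totalDegree_lt
  have : ∑ e ∈ (Finsupp.equivFunOnFinite.symm ![i, j, k, l, m, n]).support,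
      Finsupp.equivFunOnFinite.symm ![i, j, k, l, m, n] e = i + j + k + l + m + n := by
    rw [← Finsupp.degree_apply, Finsupp.degree_eq_sum, Fin.sum_univ_six]
    simp
  omega

theorem sum_poleFactor_eq_zero_of_chart {K : PolyRing} (hK : K.totalDegree ≤ 4) {a b : Fin 6}
    (hab : a ≠ b) {τ α : TimeField} {u : Fin 6 → PhaseField} (hua : u a = 1 / coords a)
    (hub : u b = -((coords b - algebraMap TimeField PhaseField τ) * coords a +
      algebraMap TimeField PhaseField α) * coords a)
    (hu : ∀ i, i ≠ a → i ≠ b → u i = coords i)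
    (h : ∃ G : PolyRing, algebraMap PolyRing PhaseField K = aeval u G) {r : Fin 6 →₀ ℕ}
    (hra : r a = 0)
    (hrb : r b = 0) {n : ℕ} (hn : n < 4) :
    ∑ i ∈ Finset.range 5, ∑ j ∈ Finset.range 5,
      coeff (r + Finsupp.single a i + Finsupp.single b j) K * (poleFactor τ α i j).coeff n = 0 := by
  obtain ⟨G, hG⟩ := h
  have hx := coords_ne_zero a
  -- The locus where the new coordinate u_b is zero: with ξ = u_a it is x = 1 / ξ, y = τ - αξ.
  let v : Fin 6 → PhaseField := Function.update (Function.update coords a (1 / coords a)) b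
    (algebraMap TimeField PhaseField τ - algebraMap TimeField PhaseField α * coords a)
  have hva : v a = 1 / coords a := by simp [v, hab]
  have hvb : v b = algebraMap TimeField PhaseField τ -
    algebraMap TimeField PhaseField α * coords a := by simp [v]
  have hv : ∀ i, i ≠ a → i ≠ b → v i = coords i := fun i ha hb => by simp [v, ha, hb]
  refine sum_poleFactor_eq_zero hK hab hva hvb hv
    (G := aeval (fun i => if i = b then (0 : PolyRing) else X i) G) ?_ hra hrb hn
  rw [aeval_eq_of_chart (s := X a) (N := Function.update X b (-((X b - C τ) * X a + C α) * X a))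
    (v := v) (u' := Function.update coords b 0) (X_ne_zero a) hua ?_ hG ?_ ?_ ?_]
  · change _ = (IsScalarTower.toAlgHom TimeField PolyRing PhaseField) _
    rw [comp_aeval_apply]
    congr 2
    ext i
    by_cases hi : i = b
    · subst hi; simp
    · simp [hi, coords]
  · intro i hi
    by_cases hb : i = b
    · subst hb
      rw [hub]
      simp [coords, algebraMap_C]
    · rw [hu i hi hb]; simp [hb, coords]
  · simp [hva, hx]
  · simp [hva, hab]
  · intro i hi
    by_cases hb : i = b
    · subst hb
      simp [hva, hvb]
      field_simp
      simp
    · simp [hb, hv i hi hb]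

theorem chart_equations {K : PolyRing} (hK : K.totalDegree ≤ 4) {a b : Fin 6}
    (hab : a ≠ b) {τ α : TimeField} {u : Fin 6 → PhaseField} (hua : u a = 1 / coords a)
    (hub : u b = -((coords b - algebraMap TimeField PhaseField τ) * coords a +
      algebraMap TimeField PhaseField α) * coords a)
    (hu : ∀ i, i ≠ a → i ≠ b → u i = coords i)
    (h : ∃ G : PolyRing, algebraMap PolyRing PhaseField K = aeval u G) {r : Fin 6 →₀ ℕ}
    (hra : r a = 0)
    (hrb : r b = 0) {d : ℕ → ℕ → TimeField} (hd0 : ∀ i j, 4 < i + j → d i j = 0)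
    (hd : ∀ i j, coeff (r + Finsupp.single a i + Finsupp.single b j) K = d i j) :
    d 4 0 = 0 ∧ d 3 0 + d 3 1 * τ = 0 ∧
      d 2 0 + d 2 1 * τ + d 2 2 * τ ^ 2 - α * d 3 1 = 0 ∧
      d 1 0 + d 1 1 * τ + d 1 2 * τ ^ 2 + d 1 3 * τ ^ 3 - α * (d 2 1 + 2 * τ * d 2 2) = 0 := by
  refine pole_equations hd0 fun n hn => ?_
  simp_rw [← hd]
  exact sum_poleFactor_eq_zero_of_chart hK hab hua hub hu h hra hrb hn

theorem con_eq (c : ℂ) :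
    con c = algebraMap TimeField PhaseField (algebraMap ℂ TimeField c) :=
  IsScalarTower.algebraMap_apply ℂ TimeField PhaseField c

theorem chart0_equations {K : PolyRing} (hK : K.totalDegree ≤ 4) {α : Fin 7 → ℂ}
    (h : ∃ G : PolyRing, algebraMap PolyRing PhaseField K = aeval (r0 α coords) G)
    (k l m n : ℕ) :
    cf K 4 0 k l m n = 0 ∧ cf K 3 0 k l m n + cf K 3 1 k l m n = 0 ∧
      cf K 2 0 k l m n + cf K 2 1 k l m n + cf K 2 2 k l m n
          - algebraMap ℂ TimeField (α 0) * cf K 3 1 k l m n = 0 ∧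
      cf K 1 0 k l m n + cf K 1 1 k l m n + cf K 1 2 k l m n + cf K 1 3 k l m n
        - algebraMap ℂ TimeField (α 0) * (cf K 2 1 k l m n + 2 * cf K 2 2 k l m n) = 0 := by
  have := chart_equations hK (a := 0) (b := 1) (by decide) (τ := 1)
    (α := algebraMap ℂ TimeField (α 0)) (u := r0 α coords) rfl (by simp [r0, con_eq])
    (fun i h1 h2 => by fin_cases i <;> first | exact absurd rfl h1 | exact absurd rfl h2 | rfl) h
    (r := Finsupp.equivFunOnFinite.symm ![0, 0, k, l, m, n]) rfl rfl
    (d := fun i j => cf K i j k l m n) (fun i j hij => cf_eq_zero hK (by omega))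
    (fun i j => by
      rw [cf]
      congr 1
      ext e
      rw [Finsupp.add_apply, Finsupp.add_apply, Finsupp.single_apply, Finsupp.single_apply]
      fin_cases e <;> simp)
  simpa using this

theorem chart1_equations {K : PolyRing} (hK : K.totalDegree ≤ 4) {α : Fin 7 → ℂ}
    (h : ∃ G : PolyRing, algebraMap PolyRing PhaseField K = aeval (r1 α coords) G)
    (k l m n : ℕ) :
    cf K 4 0 k l m n = 0 ∧ cf K 3 0 k l m n = 0 ∧ cf K 2 0 k l m n
        - algebraMap ℂ TimeField (α 1) * cf K 3 1 k l m n = 0 ∧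
      cf K 1 0 k l m n - algebraMap ℂ TimeField (α 1) * cf K 2 1 k l m n = 0 := by
  have := chart_equations hK (a := 0) (b := 1) (by decide) (τ := 0)
    (α := algebraMap ℂ TimeField (α 1)) (u := r1 α coords) rfl (by simp [r1, con_eq])
    (fun i h1 h2 => by fin_cases i <;> first | exact absurd rfl h1 | exact absurd rfl h2 | rfl) h
    (r := Finsupp.equivFunOnFinite.symm ![0, 0, k, l, m, n]) rfl rfl
    (d := fun i j => cf K i j k l m n) (fun i j hij => cf_eq_zero hK (by omega))
    (fun i j => by
      rw [cf]
      congr 1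
      ext e
      rw [Finsupp.add_apply, Finsupp.add_apply, Finsupp.single_apply, Finsupp.single_apply]
      fin_cases e <;> simp)
  simpa using this

theorem chart3_equations {K : PolyRing} (hK : K.totalDegree ≤ 4) {α : Fin 7 → ℂ}
    (h : ∃ G : PolyRing, algebraMap PolyRing PhaseField K = aeval (r3 α coords) G)
    (k l m n : ℕ) :
    cf K k l 4 0 m n = 0 ∧ cf K k l 3 0 m n = 0 ∧ cf K k l 2 0 m n
        - algebraMap ℂ TimeField (α 3) * cf K k l 3 1 m n = 0 ∧
      cf K k l 1 0 m n - algebraMap ℂ TimeField (α 3) * cf K k l 2 1 m n = 0 := by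
  have := chart_equations hK (a := 2) (b := 3) (by decide) (τ := 0)
    (α := algebraMap ℂ TimeField (α 3)) (u := r3 α coords) rfl (by simp [r3, con_eq])
    (fun i h1 h2 => by fin_cases i <;> first | exact absurd rfl h1 | exact absurd rfl h2 | rfl) h
    (r := Finsupp.equivFunOnFinite.symm ![k, l, 0, 0, m, n]) rfl rfl
    (d := fun i j => cf K k l i j m n) (fun i j hij => cf_eq_zero hK (by omega))
    (fun i j => by
      rw [cf]
      congr 1
      ext e
      rw [Finsupp.add_apply, Finsupp.add_apply, Finsupp.single_apply, Finsupp.single_apply]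
      fin_cases e <;> simp)
  simpa using this

theorem chart5_equations {K : PolyRing} (hK : K.totalDegree ≤ 4) {α : Fin 7 → ℂ}
    (h : ∃ G : PolyRing, algebraMap PolyRing PhaseField K = aeval (r5 α coords) G)
    (k l m n : ℕ) :
    cf K k l m n 4 0 = 0 ∧ cf K k l m n 3 0 = 0 ∧ cf K k l m n 2 0
        - algebraMap ℂ TimeField (α 5) * cf K k l m n 3 1 = 0 ∧
      cf K k l m n 1 0 - algebraMap ℂ TimeField (α 5) * cf K k l m n 2 1 = 0 := by
  have := chart_equations hK (a := 4) (b := 5) (by decide) (τ := 0)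
    (α := algebraMap ℂ TimeField (α 5)) (u := r5 α coords) rfl (by simp [r5, con_eq])
    (fun i h1 h2 => by fin_cases i <;> first | exact absurd rfl h1 | exact absurd rfl h2 | rfl) h
    (r := Finsupp.equivFunOnFinite.symm ![k, l, m, n, 0, 0]) rfl rfl
    (d := fun i j => cf K k l m n i j) (fun i j hij => cf_eq_zero hK (by omega))
    (fun i j => by
      rw [cf]
      congr 1
      ext e
      rw [Finsupp.add_apply, Finsupp.add_apply, Finsupp.single_apply, Finsupp.single_apply]
      fin_cases e <;> simp)
  simpa using this

theorem chart6_equations {K : PolyRing} (hK : K.totalDegree ≤ 4) {α : Fin 7 → ℂ}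
    (h : ∃ G : PolyRing, algebraMap PolyRing PhaseField K = aeval (r6 α coords) G)
    (k l m n : ℕ) :
    cf K k l m n 4 0 = 0 ∧ cf K k l m n 3 0 + cf K k l m n 3 1 * time = 0 ∧
      cf K k l m n 2 0 + cf K k l m n 2 1 * time + cf K k l m n 2 2 * time ^ 2
          - algebraMap ℂ TimeField (α 6) * cf K k l m n 3 1 = 0 ∧
      cf K k l m n 1 0 + cf K k l m n 1 1 * time + cf K k l m n 1 2 * time ^ 2
          + cf K k l m n 1 3 * time ^ 3
        - algebraMap ℂ TimeField (α 6) * (cf K k l m n 2 1 + 2 * time * cf K k l m n 2 2) = 0 := by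
  have := chart_equations hK (a := 4) (b := 5) (by decide) (τ := time)
    (α := algebraMap ℂ TimeField (α 6)) (u := r6 α coords) rfl (by simp [r6, con_eq])
    (fun i h1 h2 => by fin_cases i <;> first | exact absurd rfl h1 | exact absurd rfl h2 | rfl) h
    (r := Finsupp.equivFunOnFinite.symm ![k, l, m, n, 0, 0]) rfl rfl
    (d := fun i j => cf K k l m n i j) (fun i j hij => cf_eq_zero hK (by omega))
    (fun i j => by
      rw [cf]
      congr 1
      ext e
      rw [Finsupp.add_apply, Finsupp.add_apply, Finsupp.single_apply, Finsupp.single_apply]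
      fin_cases e <;> simp)
  simpa using this

/-! ### The monomials left by the poles in x, z and q -/

/-- The exponents of `x ^ i * y ^ j * r`, where `r` has degree `R`, that are excluded by two charts
with a pole in `x`. -/
def PairExcluded (i j R : ℕ) : Prop :=
  3 ≤ i ∨ (i = 2 ∧ j = 0) ∨ (i = 2 ∧ 0 < R) ∨ (i = 1 ∧ j = 0 ∧ 0 < R) ∨ (i = 1 ∧ j ≤ 1 ∧ 2 ≤ R)

/-- The exponents of `x ^ i * y ^ j * r`, where `r` has degree `R`, that are excluded by one chart
with a pole in `x`. -/
def SingleExcluded (i j R : ℕ) : Prop :=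
  j = 0 ∧ (3 ≤ i ∨ (i = 2 ∧ 0 < R) ∨ (i = 1 ∧ 2 ≤ R))

instance (i j R : ℕ) : Decidable (PairExcluded i j R) := by
  unfold PairExcluded; infer_instance

instance (i j R : ℕ) : Decidable (SingleExcluded i j R) := by
  unfold SingleExcluded; infer_instance

/-- The two charts resolve the same pole at the distinct values 0 and τ of the conjugate variable.
Comparing pole orders gives d_30 = 0 and τ d_31 = 0, and then the lower orders follow, since for
larger `R` the degree bound removes the remaining unknowns. -/
theorem pair_vanish {d : ℕ → ℕ → TimeField} {τ α α' : TimeField} (hτ : τ ≠ 0) {R : ℕ}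
    (hd : ∀ i j, 4 < i + j + R → d i j = 0)
    (h : d 4 0 = 0 ∧ d 3 0 = 0 ∧ d 2 0 - α * d 3 1 = 0 ∧ d 1 0 - α * d 2 1 = 0)
    (h' : d 4 0 = 0 ∧ d 3 0 + d 3 1 * τ = 0 ∧
      d 2 0 + d 2 1 * τ + d 2 2 * τ ^ 2 - α' * d 3 1 = 0 ∧
      d 1 0 + d 1 1 * τ + d 1 2 * τ ^ 2 + d 1 3 * τ ^ 3 - α' * (d 2 1 + 2 * τ * d 2 2) = 0)
    {i j : ℕ} (hij : PairExcluded i j R) : d i j = 0 := by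
  obtain ⟨h40, h30, h20, h10⟩ := h
  obtain ⟨-, h3, h2, h1⟩ := h'
  have h31 : d 3 1 = 0 := by
    rw [h30, zero_add] at h3
    exact (mul_eq_zero.1 h3).resolve_right hτ
  rw [h31, mul_zero, sub_zero] at h20 h2
  have h21 : 0 < R → d 2 1 = 0 := fun hR => by
    rw [h20, hd 2 2 (by omega), zero_mul, add_zero, zero_add] at h2
    exact (mul_eq_zero.1 h2).resolve_right hτ
  have h10' : 0 < R → d 1 0 = 0 := fun hR => by
    rwa [h21 hR, mul_zero, sub_zero] at h10
  by_cases hdeg : 4 < i + j + R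
  · exact hd i j hdeg
  rcases hij with hi | ⟨rfl, rfl⟩ | ⟨rfl, hR⟩ | ⟨rfl, rfl, hR⟩ | ⟨rfl, hj, hR⟩
  · obtain ⟨rfl, rfl⟩ | ⟨rfl, rfl⟩ | ⟨rfl, rfl⟩ :
        (i = 4 ∧ j = 0) ∨ (i = 3 ∧ j = 0) ∨ (i = 3 ∧ j = 1) := by omega
    exacts [h40, h30, h31]
  · exact h20
  · obtain rfl | rfl : j = 0 ∨ j = 1 := by omega
    exacts [h20, h21 hR]
  · exact h10' hR
  · obtain rfl | rfl : j = 0 ∨ j = 1 := by omega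
    · exact h10' (by omega)
    · rw [h10' (by omega), h21 (by omega), hd 1 2 (by omega), hd 1 3 (by omega),
        hd 2 2 (by omega)] at h1
      simpa [hτ] using h1

/-- The conditions on `K` that the difference of two Hamiltonians as in the theorem fulfils. -/
structure IsRegular (α : Fin 7 → ℂ) (K : PolyRing) : Prop where
  degree : K.totalDegree ≤ 4
  chart0 : ∃ G : PolyRing, algebraMap PolyRing PhaseField K = aeval (r0 α coords) G
  chart1 : ∃ G : PolyRing, algebraMap PolyRing PhaseField K = aeval (r1 α coords) G
  chart2 : ∃ G : PolyRing, algebraMap PolyRing PhaseField K = aeval (r2 α coords) G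
  chart3 : ∃ G : PolyRing, algebraMap PolyRing PhaseField K = aeval (r3 α coords) G
  chart5 : ∃ G : PolyRing, algebraMap PolyRing PhaseField K = aeval (r5 α coords) G
  chart6 : ∃ G : PolyRing, algebraMap PolyRing PhaseField K = aeval (r6 α coords) G
  chart34 : ∃ G : PolyRing, algebraMap PolyRing PhaseField K = aeval (r4 α (r3 α coords)) G

theorem time_ne_zero : time ≠ 0 := RatFunc.X_ne_zero

theorem cf_xy_vanish {α : Fin 7 → ℂ} {K : PolyRing} (hK : IsRegular α K) {i j k l m n : ℕ}
    (h : PairExcluded i j (k + l + m + n)) :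
    cf K i j k l m n = 0 :=
  pair_vanish (d := fun i j => cf K i j k l m n) (τ := 1) one_ne_zero
    (fun i j hij => cf_eq_zero hK.degree (by omega))
    (chart1_equations hK.degree hK.chart1 k l m n)
    (by simpa using chart0_equations hK.degree hK.chart0 k l m n) h

theorem cf_qp_vanish {α : Fin 7 → ℂ} {K : PolyRing} (hK : IsRegular α K) {i j k l m n : ℕ}
    (h : PairExcluded m n (i + j + k + l)) :
    cf K i j k l m n = 0 :=
  pair_vanish (d := fun m n => cf K i j k l m n) time_ne_zero
    (fun m n hmn => cf_eq_zero hK.degree (by omega))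
    (chart5_equations hK.degree hK.chart5 i j k l)
    (chart6_equations hK.degree hK.chart6 i j k l) h

theorem cf_zw_vanish {α : Fin 7 → ℂ} {K : PolyRing} (hK : IsRegular α K) {i j k l m n : ℕ}
    (h : SingleExcluded k l (i + j + m + n)) :
    cf K i j k l m n = 0 := by
  obtain ⟨h40, h30, h20, h10⟩ := chart3_equations hK.degree hK.chart3 i j m n
  obtain ⟨rfl, h⟩ := h
  by_cases hdeg : 4 < i + j + k + 0 + m + n
  · exact cf_eq_zero hK.degree hdeg
  rcases h with h | ⟨rfl, hR⟩ | ⟨rfl, hR⟩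
  · obtain rfl | rfl : k = 3 ∨ k = 4 := by omega
    exacts [h30, h40]
  · rwa [cf_eq_zero (k := 3) (l := 1) hK.degree (by omega), mul_zero, sub_zero] at h20
  · rwa [cf_eq_zero (k := 2) (l := 1) hK.degree (by omega), mul_zero, sub_zero] at h10

/-- The exponents of the monomials of `K` that are left by the conditions on the poles in
`x`, `z` and `q`. -/
def aliveList : List (ℕ × ℕ × ℕ × ℕ × ℕ × ℕ) :=
  [(0, 0, 0, 0, 0, 0), (0, 0, 0, 0, 0, 1), (0, 0, 0, 0, 0, 2), (0, 0, 0, 0, 0, 3),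
   (0, 0, 0, 0, 0, 4), (0, 0, 0, 0, 1, 0), (0, 0, 0, 0, 1, 1), (0, 0, 0, 0, 1, 2),
   (0, 0, 0, 0, 1, 3), (0, 0, 0, 0, 2, 1), (0, 0, 0, 0, 2, 2), (0, 0, 0, 1, 0, 0),
   (0, 0, 0, 1, 0, 1), (0, 0, 0, 1, 0, 2), (0, 0, 0, 1, 0, 3), (0, 0, 0, 1, 1, 1),
   (0, 0, 0, 1, 1, 2), (0, 0, 0, 2, 0, 0), (0, 0, 0, 2, 0, 1), (0, 0, 0, 2, 0, 2),
   (0, 0, 0, 3, 0, 0), (0, 0, 0, 3, 0, 1), (0, 0, 0, 4, 0, 0), (0, 0, 1, 0, 0, 0),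
   (0, 0, 1, 0, 0, 1), (0, 0, 1, 1, 0, 0), (0, 0, 1, 1, 0, 1), (0, 0, 1, 1, 0, 2),
   (0, 0, 1, 2, 0, 0), (0, 0, 1, 2, 0, 1), (0, 0, 1, 3, 0, 0), (0, 0, 2, 0, 0, 0),
   (0, 0, 2, 1, 0, 0), (0, 0, 2, 1, 0, 1), (0, 0, 2, 2, 0, 0), (0, 0, 3, 1, 0, 0),
   (0, 1, 0, 0, 0, 0), (0, 1, 0, 0, 0, 1), (0, 1, 0, 0, 0, 2), (0, 1, 0, 0, 0, 3),
   (0, 1, 0, 0, 1, 1), (0, 1, 0, 0, 1, 2), (0, 1, 0, 1, 0, 0), (0, 1, 0, 1, 0, 1),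
   (0, 1, 0, 1, 0, 2), (0, 1, 0, 2, 0, 0), (0, 1, 0, 2, 0, 1), (0, 1, 0, 3, 0, 0),
   (0, 1, 1, 0, 0, 0), (0, 1, 1, 1, 0, 0), (0, 1, 1, 1, 0, 1), (0, 1, 1, 2, 0, 0),
   (0, 1, 2, 1, 0, 0), (0, 2, 0, 0, 0, 0), (0, 2, 0, 0, 0, 1), (0, 2, 0, 0, 0, 2),
   (0, 2, 0, 1, 0, 0), (0, 2, 0, 1, 0, 1), (0, 2, 0, 2, 0, 0), (0, 2, 1, 1, 0, 0),
   (0, 3, 0, 0, 0, 0), (0, 3, 0, 0, 0, 1), (0, 3, 0, 1, 0, 0), (0, 4, 0, 0, 0, 0),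
   (1, 0, 0, 0, 0, 0), (1, 1, 0, 0, 0, 0), (1, 1, 0, 0, 0, 1), (1, 1, 0, 1, 0, 0),
   (1, 2, 0, 0, 0, 0), (1, 2, 0, 0, 0, 1), (1, 2, 0, 1, 0, 0), (1, 3, 0, 0, 0, 0),
   (2, 1, 0, 0, 0, 0), (2, 2, 0, 0, 0, 0)]

/-- The seventh entry is a slack variable: 7-tuples of sum 4 enumerate the exponents of degree at
most 4 in six variables, which makes the statement a finite check. -/
theorem mem_aliveList : ∀ e ∈ List.Nat.antidiagonalTuple 7 4,
    PairExcluded (e 0) (e 1) (e 2 + e 3 + e 4 + e 5) ∨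
      PairExcluded (e 4) (e 5) (e 0 + e 1 + e 2 + e 3) ∨
      SingleExcluded (e 2) (e 3) (e 0 + e 1 + e 4 + e 5) ∨
      (e 0, e 1, e 2, e 3, e 4, e 5) ∈ aliveList := by
  decide +kernel

/-- An exponent vector from its six entries. -/
def expo (e : ℕ × ℕ × ℕ × ℕ × ℕ × ℕ) : Fin 6 →₀ ℕ :=
  Finsupp.equivFunOnFinite.symm ![e.1, e.2.1, e.2.2.1, e.2.2.2.1, e.2.2.2.2.1, e.2.2.2.2.2]

theorem expo_injective : Function.Injective expo := by
  rintro ⟨i, j, k, l, m, n⟩ ⟨i', j', k', l', m', n'⟩ h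
  have h := Finsupp.equivFunOnFinite.symm.injective h
  simpa using h

theorem expo_apply (m : Fin 6 →₀ ℕ) : expo (m 0, m 1, m 2, m 3, m 4, m 5) = m := by
  ext e
  fin_cases e <;> rfl

theorem eval_eq_sum_aliveList {α : Fin 7 → ℂ} {K : PolyRing} (hK : IsRegular α K)
    (v : Fin 6 → TimeField) :
    eval v K = (aliveList.map fun e =>
      cf K e.1 e.2.1 e.2.2.1 e.2.2.2.1 e.2.2.2.2.1 e.2.2.2.2.2 * (v 0 ^ e.1 * v 1 ^ e.2.1 *
        v 2 ^ e.2.2.1 * v 3 ^ e.2.2.2.1 * v 4 ^ e.2.2.2.2.1 * v 5 ^ e.2.2.2.2.2)).sum := by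
  classical
  have h : ∀ e : ℕ × ℕ × ℕ × ℕ × ℕ × ℕ,
      cf K e.1 e.2.1 e.2.2.1 e.2.2.2.1 e.2.2.2.2.1 e.2.2.2.2.2 * (v 0 ^ e.1 * v 1 ^ e.2.1 *
        v 2 ^ e.2.2.1 * v 3 ^ e.2.2.2.1 * v 4 ^ e.2.2.2.2.1 * v 5 ^ e.2.2.2.2.2) =
      coeff (expo e) K * ∏ i, v i ^ expo e i := fun e => by
    rw [Fin.prod_univ_six]; rfl
  simp_rw [h]
  rw [← List.sum_toFinset _ (by decide), eval_eq',
    ← Finset.sum_image (f := fun m => coeff m K * ∏ i,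
        v i ^ m i) fun e _ e' _ h => expo_injective h]
  refine Finset.sum_subset (fun m hm => ?_) fun m _ hm => by
    rw [notMem_support_iff.1 hm, zero_mul]
  refine Finset.mem_image.2 ⟨(m 0, m 1, m 2, m 3, m 4, m 5), ?_, expo_apply m⟩
  rw [List.mem_toFinset]
  have hc : cf K (m 0) (m 1) (m 2) (m 3) (m 4) (m 5) ≠ 0 := by
    have := mem_support_iff.1 hm
    rwa [← expo_apply m] at this
  have hdeg : ¬ 4 < m 0 + m 1 + m 2 + m 3 + m 4 + m 5 := fun h => hc (cf_eq_zero hK.degree h)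
  rcases mem_aliveList ![m 0, m 1, m 2, m 3, m 4, m 5, 4 - (m 0 + m 1 + m 2 + m 3 + m 4 + m 5)]
    (List.Nat.mem_antidiagonalTuple.2 (by simp [Fin.sum_univ_seven]; omega)) with h | h | h | h
  · exact absurd (cf_xy_vanish hK h) hc
  · exact absurd (cf_qp_vanish hK h) hc
  · exact absurd (cf_zw_vanish hK h) hc
  · exact h

theorem eval_eq_of_isRegular {α : Fin 7 → ℂ} {K : PolyRing} (hK : IsRegular α K)
    (v : Fin 6 → TimeField) : eval v K =
      cf K 0 0 0 0 0 0 + cf K 0 0 0 0 0 1 * (v 5) + cf K 0 0 0 0 0 2 * (v 5 ^ 2) +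
      cf K 0 0 0 0 0 3 * (v 5 ^ 3) + cf K 0 0 0 0 0 4 * (v 5 ^ 4) + cf K 0 0 0 0 1 0 * (v 4) +
      cf K 0 0 0 0 1 1 * (v 4 * v 5) + cf K 0 0 0 0 1 2 * (v 4 * v 5 ^ 2) +
      cf K 0 0 0 0 1 3 * (v 4 * v 5 ^ 3) + cf K 0 0 0 0 2 1 * (v 4 ^ 2 * v 5) +
      cf K 0 0 0 0 2 2 * (v 4 ^ 2 * v 5 ^ 2) + cf K 0 0 0 1 0 0 * (v 3) +
      cf K 0 0 0 1 0 1 * (v 3 * v 5) + cf K 0 0 0 1 0 2 * (v 3 * v 5 ^ 2) +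
      cf K 0 0 0 1 0 3 * (v 3 * v 5 ^ 3) + cf K 0 0 0 1 1 1 * (v 3 * v 4 * v 5) +
      cf K 0 0 0 1 1 2 * (v 3 * v 4 * v 5 ^ 2) + cf K 0 0 0 2 0 0 * (v 3 ^ 2) +
      cf K 0 0 0 2 0 1 * (v 3 ^ 2 * v 5) + cf K 0 0 0 2 0 2 * (v 3 ^ 2 * v 5 ^ 2) +
      cf K 0 0 0 3 0 0 * (v 3 ^ 3) + cf K 0 0 0 3 0 1 * (v 3 ^ 3 * v 5) +
      cf K 0 0 0 4 0 0 * (v 3 ^ 4) + cf K 0 0 1 0 0 0 * (v 2) + cf K 0 0 1 0 0 1 * (v 2 * v 5) +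
      cf K 0 0 1 1 0 0 * (v 2 * v 3) + cf K 0 0 1 1 0 1 * (v 2 * v 3 * v 5) +
      cf K 0 0 1 1 0 2 * (v 2 * v 3 * v 5 ^ 2) + cf K 0 0 1 2 0 0 * (v 2 * v 3 ^ 2) +
      cf K 0 0 1 2 0 1 * (v 2 * v 3 ^ 2 * v 5) + cf K 0 0 1 3 0 0 * (v 2 * v 3 ^ 3) +
      cf K 0 0 2 0 0 0 * (v 2 ^ 2) + cf K 0 0 2 1 0 0 * (v 2 ^ 2 * v 3) +
      cf K 0 0 2 1 0 1 * (v 2 ^ 2 * v 3 * v 5) + cf K 0 0 2 2 0 0 * (v 2 ^ 2 * v 3 ^ 2) +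
      cf K 0 0 3 1 0 0 * (v 2 ^ 3 * v 3) + cf K 0 1 0 0 0 0 * (v 1) +
      cf K 0 1 0 0 0 1 * (v 1 * v 5) + cf K 0 1 0 0 0 2 * (v 1 * v 5 ^ 2) +
      cf K 0 1 0 0 0 3 * (v 1 * v 5 ^ 3) + cf K 0 1 0 0 1 1 * (v 1 * v 4 * v 5) +
      cf K 0 1 0 0 1 2 * (v 1 * v 4 * v 5 ^ 2) + cf K 0 1 0 1 0 0 * (v 1 * v 3) +
      cf K 0 1 0 1 0 1 * (v 1 * v 3 * v 5) + cf K 0 1 0 1 0 2 * (v 1 * v 3 * v 5 ^ 2) +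
      cf K 0 1 0 2 0 0 * (v 1 * v 3 ^ 2) + cf K 0 1 0 2 0 1 * (v 1 * v 3 ^ 2 * v 5) +
      cf K 0 1 0 3 0 0 * (v 1 * v 3 ^ 3) + cf K 0 1 1 0 0 0 * (v 1 * v 2) +
      cf K 0 1 1 1 0 0 * (v 1 * v 2 * v 3) + cf K 0 1 1 1 0 1 * (v 1 * v 2 * v 3 * v 5) +
      cf K 0 1 1 2 0 0 * (v 1 * v 2 * v 3 ^ 2) + cf K 0 1 2 1 0 0 * (v 1 * v 2 ^ 2 * v 3) +
      cf K 0 2 0 0 0 0 * (v 1 ^ 2) + cf K 0 2 0 0 0 1 * (v 1 ^ 2 * v 5) +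
      cf K 0 2 0 0 0 2 * (v 1 ^ 2 * v 5 ^ 2) + cf K 0 2 0 1 0 0 * (v 1 ^ 2 * v 3) +
      cf K 0 2 0 1 0 1 * (v 1 ^ 2 * v 3 * v 5) + cf K 0 2 0 2 0 0 * (v 1 ^ 2 * v 3 ^ 2) +
      cf K 0 2 1 1 0 0 * (v 1 ^ 2 * v 2 * v 3) + cf K 0 3 0 0 0 0 * (v 1 ^ 3) +
      cf K 0 3 0 0 0 1 * (v 1 ^ 3 * v 5) + cf K 0 3 0 1 0 0 * (v 1 ^ 3 * v 3) +
      cf K 0 4 0 0 0 0 * (v 1 ^ 4) + cf K 1 0 0 0 0 0 * (v 0) + cf K 1 1 0 0 0 0 * (v 0 * v 1) +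
      cf K 1 1 0 0 0 1 * (v 0 * v 1 * v 5) + cf K 1 1 0 1 0 0 * (v 0 * v 1 * v 3) +
      cf K 1 2 0 0 0 0 * (v 0 * v 1 ^ 2) + cf K 1 2 0 0 0 1 * (v 0 * v 1 ^ 2 * v 5) +
      cf K 1 2 0 1 0 0 * (v 0 * v 1 ^ 2 * v 3) + cf K 1 3 0 0 0 0 * (v 0 * v 1 ^ 3) +
      cf K 2 1 0 0 0 0 * (v 0 ^ 2 * v 1) + cf K 2 2 0 0 0 0 * (v 0 ^ 2 * v 1 ^ 2) := by
  rw [eval_eq_sum_aliveList hK]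
  simp [aliveList]
  ring

/-! ### Normal form of the difference and the chart r_2 -/

theorem coeff_sum_map_monomial {F : Type*} [Field F] {n : ℕ} (L : List ((Fin n → ℕ) × F))
    (hL : (L.map Prod.fst).Nodup) {m : (Fin n → ℕ) × F} (hm : m ∈ L) :
    coeff (Finsupp.equivFunOnFinite.symm m.1)
      (L.map fun m => monomial (Finsupp.equivFunOnFinite.symm m.1) m.2).sum = m.2 := by
  have hnot : ∀ (L : List ((Fin n → ℕ) × F)) (k : Fin n → ℕ), k ∉ L.map Prod.fst →
      coeff (Finsupp.equivFunOnFinite.symm k)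
        (L.map fun m => monomial (Finsupp.equivFunOnFinite.symm m.1) m.2).sum = 0 := by
    intro L k hk
    induction L with
    | nil => simp
    | cons a L ih =>
      simp only [List.map_cons, List.mem_cons, not_or] at hk
      rw [List.map_cons, List.sum_cons, coeff_add, ih hk.2, coeff_monomial, if_neg, add_zero]
      exact fun h => hk.1 (Finsupp.equivFunOnFinite.symm.injective h).symm
  induction L with
  | nil => simp at hm
  | cons a L ih =>
    rw [List.map_cons, List.nodup_cons] at hL
    rw [List.map_cons, List.sum_cons, coeff_add, coeff_monomial]
    rcases List.mem_cons.1 hm with rfl | hm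
    · rw [if_pos rfl, hnot L _ hL.1, add_zero]
    · rw [ih hL.2 hm, if_neg, zero_add]
      intro h
      exact hL.1 (List.mem_map.2 ⟨m, hm, (Finsupp.equivFunOnFinite.symm.injective h).symm⟩)

/-- If an explicit polynomial agrees with a multiple of `v i ^ N` outside the zeros of `D`, then
its coefficients of degree less than `N` in `v i` vanish. -/
theorem coeff_eq_zero_of_forall_eval {F : Type*} [Field F] [Infinite F] {n : ℕ}
    {L : List ((Fin n → ℕ) × F)}
    (hL : (L.map Prod.fst).Nodup) {i : Fin n} {N : ℕ} {D R : MvPolynomial (Fin n) F}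
    (hD : D ≠ 0) (h : ∀ v, eval v D ≠ 0 →
      (L.map fun m => m.2 * ∏ j, v j ^ m.1 j).sum = v i ^ N * eval v R)
    {m : (Fin n → ℕ) × F} (hm : m ∈ L) (hmi : m.1 i < N) : m.2 = 0 := by
  -- After multiplication by `D` the two sides agree at all points, also at the zeros of `D`; over
  -- an infinite field they are equal, and `D` cancels.
  have key : (L.map fun m => monomial (Finsupp.equivFunOnFinite.symm m.1) m.2).sum =
      X i ^ N * R := by
    refine mul_left_cancel₀ hD (funext fun v => ?_)
    rw [map_mul, map_mul, map_mul, map_pow, eval_X, map_list_sum, List.map_map]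
    by_cases hv : eval v D = 0
    · rw [hv, zero_mul, zero_mul]
    · rw [← h v hv]
      congr 3
      ext m
      simp [eval_monomial, Finsupp.prod_fintype]
  rw [← coeff_sum_map_monomial L hL hm, key, X_pow_eq_monomial, coeff_monomial_mul', if_neg]
  intro hle
  have := hle i
  simp at this
  omega

/-- The surviving monomials are arranged in powers of y + w instead of w, because y + w is the
coordinate w_2 of the chart r_2. The two side relations come from comparing the simple-pole
equations of r_0 with r_1 and of r_6 with r_5. -/
theorem exists_form_of_isRegular {α : Fin 7 → ℂ} {K : PolyRing} (hK : IsRegular α K)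
    {β : Fin 7 → TimeField} (hβ : ∀ i, β i = algebraMap ℂ TimeField (α i)) :
    ∃ (e a1 a2 a3 B2 B3 g C1 C2 C3 Cy Cw κ D0 Dy Dp E : TimeField)
      (Q P : ℕ → ℕ → ℕ → TimeField), a1 + a2 + a3 = (β 0 + β 1) * e ∧
      C1 + time * C2 + time ^ 2 * C3 = (β 5 + β 6) * g ∧
      ∀ x y z w q p, eval ![x, y, z, w, q, p] K =
      e * (x ^ 2 * y ^ 2 - x ^ 2 * y)
      + x * (-(β 1 * e) + a1 * y + a2 * y ^ 2 + a3 * y ^ 3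
        + (y ^ 2 - y) * (B2 * (y + w) + B3 * p))
      + g * (q ^ 2 * p ^ 2 - time * q ^ 2 * p)
      + q * (-(time * β 5 * g) + C1 * p + C2 * p ^ 2 + C3 * p ^ 3
        + (p ^ 2 - time * p) * (Cy * y + Cw * (y + w)))
      + κ * (z ^ 3 * w + β 3 * z ^ 2) + (z ^ 2 * w + β 3 * z) * (D0 + Dy * y + Dp * p)
      + E * z ^ 2 * w ^ 2
      + z * w * (
        Q 0 0 0 + Q 0 0 1 * p + Q 0 0 2 * (p ^ 2) + Q 0 1 0 * (y + w) + Q 0 1 1 * ((y + w) * p) +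
        Q 0 2 0 * ((y + w) ^ 2) + Q 1 0 0 * y + Q 1 0 1 * (y * p) + Q 1 1 0 * (y * (y + w)) +
        Q 2 0 0 * (y ^ 2))
      + (
        P 0 0 0 + P 0 0 1 * p + P 0 0 2 * (p ^ 2) + P 0 0 3 * (p ^ 3) + P 0 0 4 * (p ^ 4) +
        P 0 1 0 * (y + w) + P 0 1 1 * ((y + w) * p) + P 0 1 2 * ((y + w) * p ^ 2)
          + P 0 1 3 * ((y + w) * p ^ 3) +
        P 0 2 0 * ((y + w) ^ 2) + P 0 2 1 * ((y + w) ^ 2 * p) + P 0 2 2 * ((y + w) ^ 2 * p ^ 2) +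
        P 0 3 0 * ((y + w) ^ 3) + P 0 3 1 * ((y + w) ^ 3 * p) + P 0 4 0 * ((y + w) ^ 4)
          + P 1 0 0 * y +
        P 1 0 1 * (y * p) + P 1 0 2 * (y * p ^ 2) + P 1 0 3 * (y * p ^ 3) + P 1 1 0 * (y *
          (y + w)) +
        P 1 1 1 * (y * (y + w) * p) + P 1 1 2 * (y * (y + w) * p ^ 2) + P 1 2 0 * (y *
          (y + w) ^ 2) +
        P 1 2 1 * (y * (y + w) ^ 2 * p) + P 1 3 0 * (y * (y + w) ^ 3) + P 2 0 0 * (y ^ 2) +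
        P 2 0 1 * (y ^ 2 * p) + P 2 0 2 * (y ^ 2 * p ^ 2) + P 2 1 0 * (y ^ 2 * (y + w)) +
        P 2 1 1 * (y ^ 2 * (y + w) * p) + P 2 2 0 * (y ^ 2 * (y + w) ^ 2) + P 3 0 0 * (y ^ 3) +
        P 3 0 1 * (y ^ 3 * p) + P 3 1 0 * (y ^ 3 * (y + w)) + P 4 0 0 * (y ^ 4)) := by
  have r21 := (chart0_equations hK.degree hK.chart0 0 0 0 0).2.2.1
  have r1s := (chart0_equations hK.degree hK.chart0 0 0 0 0).2.2.2
  have r10 := (chart1_equations hK.degree hK.chart1 0 0 0 0).2.2.2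
  have rw1 := (chart0_equations hK.degree hK.chart0 0 1 0 0).2.2.2
  have rp1 := (chart0_equations hK.degree hK.chart0 0 0 0 1).2.2.2
  have s21 := (chart6_equations hK.degree hK.chart6 0 0 0 0).2.2.1
  have s1s := (chart6_equations hK.degree hK.chart6 0 0 0 0).2.2.2
  have s10 := (chart5_equations hK.degree hK.chart5 0 0 0 0).2.2.2
  have sy1 := (chart6_equations hK.degree hK.chart6 0 1 0 0).2.2.2
  have sw1 := (chart6_equations hK.degree hK.chart6 0 0 0 1).2.2.2
  have z20 := (chart3_equations hK.degree hK.chart3 0 0 0 0).2.2.1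
  have z10 := (chart3_equations hK.degree hK.chart3 0 0 0 0).2.2.2
  have zy1 := (chart3_equations hK.degree hK.chart3 0 1 0 0).2.2.2
  have zp1 := (chart3_equations hK.degree hK.chart3 0 0 0 1).2.2.2
  have hxy : ∀ {i j k l m n : ℕ}, PairExcluded i j (k + l + m + n) → cf K i j k l m n = 0 :=
    cf_xy_vanish hK
  have hqp : ∀ {i j k l m n : ℕ}, PairExcluded m n (i + j + k + l) → cf K i j k l m n = 0 :=
    cf_qp_vanish hK
  have hdeg : ∀ {i j k l m n : ℕ}, 4 < i + j + k + l + m + n → cf K i j k l m n = 0 :=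
    cf_eq_zero hK.degree
  have x31 : cf K 3 1 0 0 0 0 = 0 := hxy (by decide)
  have x20 : cf K 2 0 0 0 0 0 = 0 := hxy (by decide)
  have xw10 : cf K 1 0 0 1 0 0 = 0 := hxy (by decide)
  have xw21 : cf K 2 1 0 1 0 0 = 0 := hxy (by decide)
  have xw13 : cf K 1 3 0 1 0 0 = 0 := hdeg (by decide)
  have xw22 : cf K 2 2 0 1 0 0 = 0 := hdeg (by decide)
  have xp10 : cf K 1 0 0 0 0 1 = 0 := hxy (by decide)
  have xp21 : cf K 2 1 0 0 0 1 = 0 := hxy (by decide)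
  have xp13 : cf K 1 3 0 0 0 1 = 0 := hdeg (by decide)
  have xp22 : cf K 2 2 0 0 0 1 = 0 := hdeg (by decide)
  have q31 : cf K 0 0 0 0 3 1 = 0 := hqp (by decide)
  have q20 : cf K 0 0 0 0 2 0 = 0 := hqp (by decide)
  have qy10 : cf K 0 1 0 0 1 0 = 0 := hqp (by decide)
  have qy21 : cf K 0 1 0 0 2 1 = 0 := hqp (by decide)
  have qy13 : cf K 0 1 0 0 1 3 = 0 := hdeg (by decide)
  have qy22 : cf K 0 1 0 0 2 2 = 0 := hdeg (by decide)
  have qw10 : cf K 0 0 0 1 1 0 = 0 := hqp (by decide)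
  have qw21 : cf K 0 0 0 1 2 1 = 0 := hqp (by decide)
  have qw13 : cf K 0 0 0 1 1 3 = 0 := hdeg (by decide)
  have qw22 : cf K 0 0 0 1 2 2 = 0 := hdeg (by decide)
  simp only [← hβ, x31, x20, xw10, xw21, xw13, xw22, xp10, xp21, xp13, xp22, q31, q20, qy10, qy21,
    qy13, qy22, qw10, qw21, qw13, qw22, mul_zero, zero_mul, add_zero, zero_add, sub_zero]
    at r21 r1s r10 rw1 rp1 s21 s1s s10 sy1 sw1 z20 z10 zy1 zp1
  replace s21 : cf K 0 0 0 0 2 1 + time * cf K 0 0 0 0 2 2 = 0 := by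
    apply mul_left_cancel₀ time_ne_zero
    linear_combination s21
  replace sy1 : cf K 0 1 0 0 1 1 + time * cf K 0 1 0 0 1 2 = 0 := by
    apply mul_left_cancel₀ time_ne_zero
    linear_combination sy1
  replace sw1 : cf K 0 0 0 1 1 1 + time * cf K 0 0 0 1 1 2 = 0 := by
    apply mul_left_cancel₀ time_ne_zero
    linear_combination sw1
  refine ⟨cf K 2 2 0 0 0 0, cf K 1 1 0 0 0 0, cf K 1 2 0 0 0 0 + cf K 1 2 0 1 0 0,
    cf K 1 3 0 0 0 0 - cf K 1 2 0 1 0 0, cf K 1 2 0 1 0 0, cf K 1 2 0 0 0 1, cf K 0 0 0 0 2 2,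
    cf K 0 0 0 0 1 1, cf K 0 0 0 0 1 2, cf K 0 0 0 0 1 3, cf K 0 1 0 0 1 2 - cf K 0 0 0 1 1 2,
    cf K 0 0 0 1 1 2, cf K 0 0 3 1 0 0, cf K 0 0 2 1 0 0, cf K 0 1 2 1 0 0, cf K 0 0 2 1 0 1,
    cf K 0 0 2 2 0 0,
    -- Binomial expansion of w = (y + w) - y, collecting y^a (y + w)^b p^c. In `Q` a factor zw has
    -- been taken out, hence the shifted exponent of w.
    fun a b c => ∑ s ∈ Finset.range (a + 1),
      (-1) ^ s * ((b + s).choose b : TimeField) * cf K 0 (a - s) 1 (b + s + 1) 0 c,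
    fun a b c => ∑ s ∈ Finset.range (a + 1),
      (-1) ^ s * ((b + s).choose b : TimeField) * cf K 0 (a - s) 0 (b + s) 0 c, ?_, ?_, ?_⟩
  · linear_combination r1s - r10 + (β 0 - β 1) * r21
  · apply mul_left_cancel₀ time_ne_zero
    linear_combination s1s - s10 + (β 6 - β 5) * s21
  · intro x y z w q p
    rw [eval_eq_of_isRegular hK]
    simp [Finset.sum_range_succ, Nat.choose]
    linear_combination r21 * (x ^ 2 * y) + (r10 + β 1 * r21) * x + rw1 * (x * y * w)
      + rp1 * (x * y * p) + s21 * (q ^ 2 * p) + (s10 + β 5 * s21) * q + sy1 * (q * p * y)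
      + sw1 * (q * p * w) + z20 * z ^ 2 + z10 * z + zy1 * (z * y) + zp1 * (z * p)

-- On the locus x_2 = 0 of the chart r_2 one has x = z + α_2 η, y = 1 / η, w = w_2 - 1 / η. Absence
-- of poles at η = 0 ties the zw-part to the xy-part and determines every term of `P` containing an
-- explicit y. Polynomials in y + w and p alone are regular there and stay free.
set_option maxHeartbeats 1000000 in
theorem exists_reduced_form_of_isRegular {α : Fin 7 → ℂ} {K : PolyRing} (hK : IsRegular α K)
    {β : Fin 7 → TimeField} (hβ : ∀ i, β i = algebraMap ℂ TimeField (α i)) :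
    ∃ (e a1 a2 a3 B2 B3 g C1 C2 C3 Cw : TimeField) (P : ℕ → ℕ → TimeField),
      a1 + a2 + a3 = (β 0 + β 1) * e ∧ C1 + time * C2 + time ^ 2 * C3 = (β 5 + β 6) * g ∧
      ∀ x y z w q p, eval ![x, y, z, w, q, p] K =
      e * (x ^ 2 * y ^ 2 - x ^ 2 * y)
      + x * (-(β 1 * e) + a1 * y + a2 * y ^ 2 + a3 * y ^ 3
        + (y ^ 2 - y) * (B2 * (y + w) + B3 * p))
      + g * (q ^ 2 * p ^ 2 - time * q ^ 2 * p)
      + q * (-(time * β 5 * g) + C1 * p + C2 * p ^ 2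
        + C3 * p ^ 3 + (p ^ 2 - time * p) * (Cw * (y + w)))
      + (z ^ 2 * w + β 3 * z) * (-e + 2 * e * y) + e * z ^ 2 * w ^ 2
      + z * w * (a1 + 2 * e * β 3 + 2 * e * β 2 + (a2 - B2) * (y + w)
        + (B2 + a3) * (y + w) ^ 2 + a2 * y + (B2 + a3) * y * (y + w) + a3 * y ^ 2
        + B3 * (-p + (y + w) * p + y * p))
      - β 2 * (a3 * y ^ 2 + a2 * y + B2 * y * (y + w) + B3 * y * p)
      + (
        P 0 0 + P 0 1 * p + P 0 2 * (p ^ 2) + P 0 3 * (p ^ 3) + P 0 4 * (p ^ 4) + P 1 0 * (y + w) +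
        P 1 1 * ((y + w) * p) + P 1 2 * ((y + w) * p ^ 2) + P 1 3 * ((y + w) * p ^ 3)
          + P 2 0 * ((y + w) ^ 2) +
        P 2 1 * ((y + w) ^ 2 * p) + P 2 2 * ((y + w) ^ 2 * p ^ 2) + P 3 0 * ((y + w) ^ 3)
          + P 3 1 * ((y + w) ^ 3 * p) +
        P 4 0 * ((y + w) ^ 4)) := by
  obtain ⟨e, a1, a2, a3, B2, B3, g, C1, C2, C3, Cy, Cw, κ, D0, Dy, Dp, E, Q, P, ha1, hC1, hf⟩ :=
    exists_form_of_isRegular hK hβ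
  obtain ⟨G, hG⟩ := hK.chart2
  let R : MvPolynomial (Fin 5) TimeField := aeval ![0, X 0, X 1, X 2, X 3, X 4] G
  have hR : ∀ v : Fin 5 → TimeField, v 0 ≠ 0 →
      eval ![v 1 + β 2 * v 0, 1 / v 0, v 1, v 2 - 1 / v 0, v 3, v 4] K = eval v R := by
    intro v hv
    rw [← coe_aeval_eq_eval, ← coe_aeval_eq_eval]
    simp only [RingHom.coe_coe, R, comp_aeval_apply]
    refine aeval_eq_of_chart (s := X 1) (a := 1)
      (N := ![-((X 0 - X 2) * X 1 - C (β 2)) * X 1, 0, X 2, X 3 + X 1, X 4, X 5])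
      (X_ne_zero 1) rfl ?_ hG ?_ ?_ ?_
    · intro i hi
      fin_cases i <;> simp [r2, coords, con_eq, hβ, algebraMap_C] at hi ⊢
    · simpa using hv
    · simp
    · intro i hi
      fin_cases i <;> simp at hi ⊢
      field_simp
      simp
  -- The list is the expansion of η^4 K on this locus, with exponents in the order η, z, w_2, q, p.
  -- Entries with η-exponent below 4 are the polar part.
  have key := fun m => coeff_eq_zero_of_forall_eval (m := m) (i := 0) (N := 4) (D := X 0) (R := R)
    (L := [
      (![0, 0, 0, 0, 0], P 4 0 0), (![1, 0, 0, 0, 0], P 3 0 0),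
      (![1, 0, 0, 0, 1], P 3 0 1), (![1, 0, 1, 0, 0], P 3 1 0),
      (![1, 1, 0, 0, 0], -Q 2 0 0 + a3), (![2, 0, 0, 0, 0], P 2 0 0 + a3 * β 2),
      (![2, 0, 0, 0, 1], P 2 0 1), (![2, 0, 0, 0, 2], P 2 0 2),
      (![2, 0, 1, 0, 0], P 2 1 0), (![2, 0, 1, 0, 1], P 2 1 1),
      (![2, 0, 2, 0, 0], P 2 2 0), (![2, 1, 0, 0, 0], -Q 1 0 0 + a2),
      (![2, 1, 0, 0, 1], B3 - Q 1 0 1), (![2, 1, 1, 0, 0], B2 - Q 1 1 0 + Q 2 0 0),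
      (![2, 2, 0, 0, 0], -Dy + E + e), (![3, 0, 0, 0, 0], P 1 0 0 + a2 * β 2),
      (![3, 0, 0, 0, 1], P 1 0 1 + B3 * β 2), (![3, 0, 0, 0, 2], P 1 0 2),
      (![3, 0, 0, 0, 3], P 1 0 3), (![3, 0, 0, 1, 1], -Cy * time),
      (![3, 0, 0, 1, 2], Cy), (![3, 0, 1, 0, 0], P 1 1 0 + B2 * β 2),
      (![3, 0, 1, 0, 1], P 1 1 1), (![3, 0, 1, 0, 2], P 1 1 2),
      (![3, 0, 2, 0, 0], P 1 2 0), (![3, 0, 2, 0, 1], P 1 2 1),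
      (![3, 0, 3, 0, 0], P 1 3 0),
      (![3, 1, 0, 0, 0], -Q 0 0 0 + a1 + Dy * β 3 + 2 * e * β 2),
      (![3, 1, 0, 0, 1], -B3 - Q 0 0 1), (![3, 1, 0, 0, 2], -Q 0 0 2),
      (![3, 1, 1, 0, 0], -B2 - Q 0 1 0 + Q 1 0 0),
      (![3, 1, 1, 0, 1], -Q 0 1 1 + Q 1 0 1), (![3, 1, 2, 0, 0], -Q 0 2 0 + Q 1 1 0),
      (![3, 2, 0, 0, 0], -D0 - e), (![3, 2, 0, 0, 1], -Dp),
      (![3, 2, 1, 0, 0], Dy - 2 * E), (![3, 3, 0, 0, 0], -κ),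
      (![4, 0, 0, 0, 0], P 0 0 0 + a1 * β 2 + e * β 2 ^ 2),
      (![4, 0, 0, 0, 1], P 0 0 1 - B3 * β 2), (![4, 0, 0, 0, 2], P 0 0 2),
      (![4, 0, 0, 0, 3], P 0 0 3), (![4, 0, 0, 0, 4], P 0 0 4),
      (![4, 0, 0, 1, 0], -g * time * β 5), (![4, 0, 0, 1, 1], C1),
      (![4, 0, 0, 1, 2], C2), (![4, 0, 0, 1, 3], C3), (![4, 0, 0, 2, 1], -g * time),
      (![4, 0, 0, 2, 2], g), (![4, 0, 1, 0, 0], P 0 1 0 - B2 * β 2),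
      (![4, 0, 1, 0, 1], P 0 1 1), (![4, 0, 1, 0, 2], P 0 1 2),
      (![4, 0, 1, 0, 3], P 0 1 3), (![4, 0, 1, 1, 1], -Cw * time),
      (![4, 0, 1, 1, 2], Cw), (![4, 0, 2, 0, 0], P 0 2 0), (![4, 0, 2, 0, 1], P 0 2 1),
      (![4, 0, 2, 0, 2], P 0 2 2), (![4, 0, 3, 0, 0], P 0 3 0),
      (![4, 0, 3, 0, 1], P 0 3 1), (![4, 0, 4, 0, 0], P 0 4 0),
      (![4, 1, 0, 0, 0], D0 * β 3 - e * β 1 - 2 * e * β 2), (![4, 1, 0, 0, 1], Dp * β 3),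
      (![4, 1, 1, 0, 0], Q 0 0 0), (![4, 1, 1, 0, 1], Q 0 0 1),
      (![4, 1, 1, 0, 2], Q 0 0 2), (![4, 1, 2, 0, 0], Q 0 1 0),
      (![4, 1, 2, 0, 1], Q 0 1 1), (![4, 1, 3, 0, 0], Q 0 2 0),
      (![4, 2, 0, 0, 0], β 3 * κ), (![4, 2, 1, 0, 0], D0), (![4, 2, 1, 0, 1], Dp),
      (![4, 2, 2, 0, 0], E), (![4, 3, 1, 0, 0], κ),
      (![5, 0, 0, 0, 0], -e * β 2 ^ 2 - e * β 1 * β 2)])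
    (by simp only [List.map_cons, List.map_nil]; decide +kernel) (X_ne_zero 0) (by
      intro v hv
      rw [eval_X] at hv
      rw [← hR v hv, hf]
      simp [Fin.prod_univ_five]
      field_simp
      ring)
  simp at key
  obtain ⟨P400, P300, P301, P310, Q200, P200, P201, P202, P210, P211, P220, Q100, Q101, Q110, hE,
    P100, P101, P102, P103, -, rfl, P110, P111, P112, P120, P121, P130, Q000, Q001, Q002, Q010,
    Q011, Q020, hD0, rfl, hDy, rfl⟩ := key
  replace Q200 : Q 2 0 0 = a3 := by linear_combination -Q200
  replace Q100 : Q 1 0 0 = a2 := by linear_combination -Q100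
  replace Q101 : Q 1 0 1 = B3 := by linear_combination -Q101
  replace Q110 : Q 1 1 0 = B2 + a3 := by linear_combination -Q110 + Q200
  obtain rfl : E = e := by linear_combination -hE - hDy
  obtain rfl : Dy = 2 * E := by linear_combination hDy
  obtain rfl : D0 = -E := by linear_combination -hD0
  replace Q000 : Q 0 0 0 = a1 + 2 * E * β 3 + 2 * E * β 2 := by linear_combination -Q000
  replace Q001 : Q 0 0 1 = -B3 := by linear_combination -Q001
  replace Q010 : Q 0 1 0 = a2 - B2 := by linear_combination -Q010 + Q100
  replace Q011 : Q 0 1 1 = B3 := by linear_combination -Q011 + Q101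
  replace Q020 : Q 0 2 0 = B2 + a3 := by linear_combination -Q020 + Q110
  replace P200 : P 2 0 0 = -(a3 * β 2) := by linear_combination P200
  replace P100 : P 1 0 0 = -(a2 * β 2) := by linear_combination P100
  replace P101 : P 1 0 1 = -(B3 * β 2) := by linear_combination P101
  replace P110 : P 1 1 0 = -(B2 * β 2) := by linear_combination P110
  refine ⟨E, a1, a2, a3, B2, B3, g, C1, C2, C3, Cw, fun b c => P 0 b c, ha1, hC1,
      fun x y z w q p => ?_⟩
  rw [hf]
  simp only [P400, P300, P301, P310, Q200, P200, P201, P202, P210, P211, P220, Q100, Q101, Q110,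
    P100, P101, P102, P103, P110, P111, P112, P120, P121, P130, Q000, Q001, Q002, Q010, Q011, Q020]
  ring

/-! ### The chart r_4 on top of r_3 -/

/-- The locus z_4 = 0 with w_4 = ξ: then w_3 = 1 / ξ and z_3 = q + α_4 ξ = ζ, and undoing r_3 gives
z = 1 / ζ and zw = -(ζ / ξ + α_3); the old p is p_4 - 1 / ξ. -/
theorem eval_eq_of_chart34 {α : Fin 7 → ℂ} {β : Fin 7 → TimeField}
    (hβ : ∀ i, β i = algebraMap ℂ TimeField (α i)) {K G : PolyRing}
    (hG : algebraMap PolyRing PhaseField K = aeval (r4 α (r3 α coords)) G)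
    {ξ x y q p ζ : TimeField} (hζ : ζ = q + β 4 * ξ) (hξ0 : ξ ≠ 0) (hζ0 : ζ ≠ 0) :
    eval ![x, y, 1 / ζ, -(ζ / ξ + β 3) * ζ, q, p - 1 / ξ] K = eval ![x, y, 0, ξ, q, p] G := by
  rw [← coe_aeval_eq_eval, ← coe_aeval_eq_eval]
  simp only [RingHom.coe_coe]
  have h3 : algebraMap PolyRing PhaseField (-(X 3 * X 2 + C (β 3))) =
      -(coords 3 * coords 2 + con (α 3)) := by
    simp [coords, con_eq, hβ, algebraMap_C]
  have h4 : algebraMap PolyRing PhaseField (C (β 4)) = con (α 4) := by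
    rw [algebraMap_C, con_eq, hβ]
  -- Although z_3 = 1 / z, the product z_3 w_3 = σ is a polynomial, and so is z_4. The only
  -- denominator of the composite chart is thus w_3 = σ z.
  obtain ⟨σ, hσ⟩ : ∃ σ : PolyRing, σ = -(X 3 * X 2 + C (β 3)) := ⟨_, rfl⟩
  rw [← hσ] at h3
  have h2 : algebraMap PolyRing PhaseField (X 2) = coords 2 := rfl
  have h5 : algebraMap PolyRing PhaseField (X 4) = coords 4 := rfl
  have h6 : algebraMap PolyRing PhaseField (X 5) = coords 5 := rfl
  have hz := coords_ne_zero 2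
  have hσv : aeval ![x, y, 1 / ζ, -(ζ / ξ + β 3) * ζ, q, p - 1 / ξ] σ = ζ / ξ := by
    rw [hσ]
    simp
    field_simp
    ring
  refine aeval_eq_of_chart (s := σ * X 2) (a := 3)
    (N := ![X 0, X 1, -((σ - X 4 * (σ * X 2)) - C (β 4)) * (σ * X 2), 0, X 4, X 5 + σ * X 2])
    ?_ (by rw [map_mul, h3]; rfl) ?_ hG ?_ ?_ ?_
  · intro h
    have h7 := congrArg (algebraMap PolyRing PhaseField) h
    rw [map_mul, h3, map_zero] at h7
    exact chart34_pole_ne_zero (α 3) h7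
  · intro i hi
    fin_cases i
    · rfl
    · rfl
    · change -((1 / coords 2 - coords 4) * (-(coords 3 * coords 2 + con (α 3)) * coords 2)
        - con (α 4)) * (-(coords 3 * coords 2 + con (α 3)) * coords 2) = algebraMap _ _
          (-((σ - X 4 * (σ * X 2)) - C (β 4)) * (σ * X 2))
      simp only [map_mul, map_neg, map_sub, h2, h3, h4, h5]
      field_simp
      ring
    · exact absurd rfl hi
    · rfl
    · change coords 5 + _ = algebraMap _ _ (X 5 + σ * X 2)
      rw [map_add, map_mul, h2, h3, h6]
      rfl
  · rw [map_mul, hσv]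
    simp [hξ0, hζ0]
  · rw [map_mul, hσv]
    simp
    field_simp
  · intro i hi
    fin_cases i
    · simp
    · simp
    · change 0 = aeval _ (-((σ - X 4 * (σ * X 2)) - C (β 4)) * (σ * X 2))
      have h7 : ζ / ξ - q * (ζ / ξ * (1 / ζ)) - β 4 = 0 := by
        field_simp
        rw [hζ]
        ring
      simp only [map_mul, map_neg, map_sub, hσv, aeval_X, aeval_C]
      exact (mul_eq_zero_of_left (neg_eq_zero.2 h7) _).symm
    · exact absurd rfl hi
    · simp
    · change p = aeval _ (X 5 + σ * X 2)
      simp only [map_add, map_mul, hσv, aeval_X]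
      simp
      field_simp
      ring

theorem exists_eval_eq_of_chart34 {α : Fin 7 → ℂ} {β : Fin 7 → TimeField}
    (hβ : ∀ i, β i = algebraMap ℂ TimeField (α i)) {K G : PolyRing}
    (hG : algebraMap PolyRing PhaseField K = aeval (r4 α (r3 α coords)) G) (x y : TimeField) :
    ∃ R : MvPolynomial (Fin 3) TimeField, ∀ ξ q p ζ, ζ = q + β 4 * ξ → ξ ≠ 0 → ζ ≠ 0 →
      eval ![x, y, 1 / ζ, -(ζ / ξ + β 3) * ζ, q, p - 1 / ξ] K = eval ![ξ, q, p] R := by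
  refine ⟨aeval ![C x, C y, 0, X 0, X 1, X 2] G, fun ξ q p ζ hζ hξ0 hζ0 => ?_⟩
  rw [eval_eq_of_chart34 hβ hG hζ hξ0 hζ0, ← coe_aeval_eq_eval, ← coe_aeval_eq_eval]
  simp only [RingHom.coe_coe, comp_aeval_apply]
  congr 2
  ext i
  fin_cases i <;> simp

set_option maxHeartbeats 2000000 in
set_option maxRecDepth 4000 in
/-- The pole terms in `ξ` of the reduced form at `x = y = 0`, in the coordinates of the last
chart, vanish only if the parameters satisfy the relations listed here. -/
theorem relations_of_chart34 {F : Type*} [Field F] [Infinite F] {β : Fin 7 → F}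
    {τ e a1 a2 a3 B2 B3 g C1 C2 C3 Cw : F} {P : ℕ → ℕ → F} {R : MvPolynomial (Fin 3) F}
    (h : ∀ ξ q p ζ, ζ = q + β 4 * ξ → ξ ≠ 0 → ζ ≠ 0 → ∀ s w, s = -(ζ / ξ + β 3) →
      w = s * ζ →
      g * (q ^ 2 * (p - 1 / ξ) ^ 2 - τ * q ^ 2 * (p - 1 / ξ))
      + q * (-(τ * β 5 * g) + C1 * (p - 1 / ξ) + C2 * (p - 1 / ξ) ^ 2
        + C3 * (p - 1 / ξ) ^ 3 + ((p - 1 / ξ) ^ 2 - τ * (p - 1 / ξ)) * (Cw * w))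
      + e / ξ + e * s ^ 2
      + s * (a1 + 2 * e * β 3 + 2 * e * β 2 + (a2 - B2) * w
        + (B2 + a3) * w ^ 2 + B3 * (-(p - 1 / ξ) + w * (p - 1 / ξ)))
      + (P 0 0 + P 0 1 * (p - 1 / ξ) + P 0 2 * (p - 1 / ξ) ^ 2 + P 0 3 * (p - 1 / ξ) ^ 3
        + P 0 4 * (p - 1 / ξ) ^ 4 + P 1 0 * w + P 1 1 * (w * (p - 1 / ξ))
        + P 1 2 * (w * (p - 1 / ξ) ^ 2) + P 1 3 * (w * (p - 1 / ξ) ^ 3) + P 2 0 * w ^ 2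
        + P 2 1 * (w ^ 2 * (p - 1 / ξ)) + P 2 2 * (w ^ 2 * (p - 1 / ξ) ^ 2) + P 3 0 * w ^ 3
        + P 3 1 * (w ^ 3 * (p - 1 / ξ)) + P 4 0 * w ^ 4) = eval ![ξ, q, p] R) :
    (B3 = 0 ∧ Cw = 0 ∧ C2 = 0 ∧ C3 = 0 ∧ a2 = B2 ∧ a3 = -B2 ∧ g = e ∧
      a1 + C1 + 2 * e * (β 2 + β 3 + β 4) = 0) ∧
    P 0 1 = e ∧ P 0 2 = 0 ∧ P 0 3 = 0 ∧ P 0 4 = 0 ∧ P 1 0 = e * τ ∧ P 1 1 = -2 * e ∧ P 1 2 = 0 ∧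
      P 1 3 = 0 ∧ P 2 0 = 0 ∧ P 2 1 = 0 ∧ P 2 2 = 0 ∧ P 3 0 = 0 ∧ P 3 1 = 0 ∧ P 4 0 = 0 := by
  -- The list expands ξ^4 times the left-hand side in ξ, q, p; `D` is ξζ, as the identity is known
  -- only where both are nonzero.
  have key := fun m => coeff_eq_zero_of_forall_eval (m := m) (i := 0) (N := 4)
    (D := X 0 * (X 1 + C (β 4) * X 0)) (R := R)
    (L := ([
      (![0, 0, 0], P 0 4), (![0, 2, 0], P 1 3), (![0, 4, 0], P 2 2),
      (![0, 6, 0], P 3 1), (![0, 8, 0], P 4 0), (![1, 0, 0], -P 0 3),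
      (![1, 0, 1], -4 * P 0 4), (![1, 1, 0], -C3 + P 1 3 * β 3 + 2 * P 1 3 * β 4),
      (![1, 2, 0], -P 1 2), (![1, 2, 1], -3 * P 1 3), (![1, 3, 0], -B3 - Cw + 2 * P 2 2 * β 3 + 4
        * P 2 2 * β 4), (![1, 4, 0], -P 2 1), (![1, 4, 1], -2 * P 2 2),
      (![1, 5, 0], -B2 - a3 + 3 * P 3 1 * β 3 + 6 * P 3 1 * β 4),
      (![1, 6, 0], -P 3 0), (![1, 6, 1], -P 3 1), (![1, 7, 0], 4 * P 4 0 * β 3 + 8 * P 4 0 * β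
        4), (![2, 0, 0], P 0 2 + P 1 3 * β 4 ^ 2 + P 1 3 * β 3 * β 4),
      (![2, 0, 1], 3 * P 0 3), (![2, 0, 2], 6 * P 0 4), (![2, 1, 0], -B3 + C2 - P 1 2 * β 3 - 2 *
        P 1 2 * β 4), (![2, 1, 1], 3 * C3 - 3 * P 1 3 * β 3 - 6 * P 1 3 * β 4),
      (![2, 2, 0], P 1 1 + e + g - 2 * B3 * β 3 - 3 * B3 * β 4 - Cw * β 3 - 2 * Cw * β 4 + P 2 2
        * β 3 ^ 2 + 6 * P 2 2 * β 4 ^ 2 + 6 * P 2 2 * β 3 * β 4),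
      (![2, 2, 1], 2 * P 1 2), (![2, 2, 2], 3 * P 1 3), (![2, 3, 0], -B2 + a2 - Cw * τ - 2 * P 2
        1 * β 3 - 4 * P 2 1 * β 4), (![2, 3, 1], B3 + 2 * Cw - 4 * P 2 2 * β 3 - 8 * P 2 2 * β
        4), (![2, 4, 0], P 2 0 - 3 * B2 * β 3 - 5 * B2 * β 4 + 3 * P 3 1 * β 3 ^ 2 + 15 * P 3 1 *
        β 4 ^ 2 - 3 * a3 * β 3 - 5 * a3 * β 4 + 15 * P 3 1 * β 3 * β 4),
      (![2, 4, 1], P 2 1), (![2, 4, 2], P 2 2), (![2, 5, 0], -3 * P 3 0 * β 3 - 6 * P 3 0 * β 4),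
      (![2, 5, 1], -3 * P 3 1 * β 3 - 6 * P 3 1 * β 4), (![2, 6, 0], 6 * P 4 0 * β 3 ^ 2 + 28 * P
        4 0 * β 4 ^ 2 + 28 * P 4 0 * β 3 * β 4), (![3, 0, 0], -P 0 1 + e - B3 * β 3 - B3 * β 4 -
        P 1 2 * β 4 ^ 2 - P 1 2 * β 3 * β 4), (![3, 0, 1], -2 * P 0 2 - 3 * P 1 3 * β 4 ^ 2 - 3 *
        P 1 3 * β 3 * β 4), (![3, 0, 2], -3 * P 0 3), (![3, 0, 3], -4 * P 0 4),
      (![3, 1, 0], -C1 - a1 - B3 * β 3 ^ 2 - 3 * B3 * β 4 ^ 2 - Cw * β 4 ^ 2 + P 1 1 * β 3 + 2 *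
        P 1 1 * β 4 + 4 * P 2 2 * β 4 ^ 3 - 2 * e * β 2 + 2 * e * β 4 - 4 * B3 * β 3 * β 4 - Cw *
        β 3 * β 4 + 6 * P 2 2 * β 3 * β 4 ^ 2 + 2 * P 2 2 * β 3 ^ 2 * β 4),
      (![3, 1, 1], B3 - 2 * C2 + 2 * P 1 2 * β 3 + 4 * P 1 2 * β 4),
      (![3, 1, 2], -3 * C3 + 3 * P 1 3 * β 3 + 6 * P 1 3 * β 4),
      (![3, 2, 0], -P 1 0 - 2 * B2 * β 3 - 3 * B2 * β 4 - P 2 1 * β 3 ^ 2 - 6 * P 2 1 * β 4 ^ 2 +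
        2 * a2 * β 3 + 3 * a2 * β 4 + g * τ - Cw * τ * β 3 - 2 * Cw * τ * β 4 - 6 * P 2 1 * β 3 *
        β 4), (![3, 2, 1], -P 1 1 - 2 * g + 2 * B3 * β 3 + 3 * B3 * β 4 + 2 * Cw * β 3 + 4 * Cw *
        β 4 - 2 * P 2 2 * β 3 ^ 2 - 12 * P 2 2 * β 4 ^ 2 - 12 * P 2 2 * β 3 * β 4),
      (![3, 2, 2], -P 1 2), (![3, 2, 3], -P 1 3), (![3, 3, 0], -3 * B2 * β 3 ^ 2 - 10 * B2 * β 4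
        ^ 2 + 2 * P 2 0 * β 3 + 4 * P 2 0 * β 4 + P 3 1 * β 3 ^ 3 + 20 * P 3 1 * β 4 ^ 3 - 3 * a3
        * β 3 ^ 2 - 10 * a3 * β 4 ^ 2 - 12 * B2 * β 3 * β 4 + 30 * P 3 1 * β 3 * β 4 ^ 2 + 12 * P
        3 1 * β 3 ^ 2 * β 4 - 12 * a3 * β 3 * β 4), (![3, 3, 1], Cw * τ + 2 * P 2 1 * β 3 + 4 * P
        2 1 * β 4), (![3, 3, 2], -Cw + 2 * P 2 2 * β 3 + 4 * P 2 2 * β 4),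
      (![3, 4, 0], -3 * P 3 0 * β 3 ^ 2 - 15 * P 3 0 * β 4 ^ 2 - 15 * P 3 0 * β 3 * β 4),
      (![3, 4, 1], -3 * P 3 1 * β 3 ^ 2 - 15 * P 3 1 * β 4 ^ 2 - 15 * P 3 1 * β 3 * β 4),
      (![3, 5, 0], 4 * P 4 0 * β 3 ^ 3 + 56 * P 4 0 * β 4 ^ 3 + 84 * P 4 0 * β 3 * β 4 ^ 2 + 36 *
        P 4 0 * β 3 ^ 2 * β 4), (![4, 0, 0], P 0 0 - B3 * β 4 ^ 3 + P 1 1 * β 4 ^ 2 + P 2 2 * β 4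
        ^ 4 - a1 * β 3 - a1 * β 4 - e * β 3 ^ 2 + e * β 4 ^ 2 - 2 * B3 * β 3 * β 4 ^ 2 - B3 * β 3
        ^ 2 * β 4 + P 1 1 * β 3 * β 4 + 2 * P 2 2 * β 3 * β 4 ^ 3 + P 2 2 * β 3 ^ 2 * β 4 ^ 2 - 2
        * e * β 2 * β 3 - 2 * e * β 2 * β 4), (![4, 0, 1], P 0 1 + B3 * β 3 + B3 * β 4 + 2 * P 1
        2 * β 4 ^ 2 + 2 * P 1 2 * β 3 * β 4), (![4, 0, 2], P 0 2 + 3 * P 1 3 * β 4 ^ 2 + 3 * P 1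
        3 * β 3 * β 4), (![4, 0, 3], P 0 3), (![4, 0, 4], P 0 4),
      (![4, 1, 0], -B2 * β 3 ^ 2 - 3 * B2 * β 4 ^ 2 - P 1 0 * β 3 - 2 * P 1 0 * β 4 - 4 * P 2 1 *
        β 4 ^ 3 + a2 * β 3 ^ 2 + 3 * a2 * β 4 ^ 2 - 4 * B2 * β 3 * β 4 - Cw * τ * β 4 ^ 2 - 6 * P
        2 1 * β 3 * β 4 ^ 2 - 2 * P 2 1 * β 3 ^ 2 * β 4 + 4 * a2 * β 3 * β 4 - g * τ * β 5 - Cw *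
        τ * β 3 * β 4), (![4, 1, 1], C1 + B3 * β 3 ^ 2 + 3 * B3 * β 4 ^ 2 + 2 * Cw * β 4 ^ 2 - P
        1 1 * β 3 - 2 * P 1 1 * β 4 - 8 * P 2 2 * β 4 ^ 3 + 4 * B3 * β 3 * β 4 + 2 * Cw * β 3 * β
        4 - 12 * P 2 2 * β 3 * β 4 ^ 2 - 4 * P 2 2 * β 3 ^ 2 * β 4),
      (![4, 1, 2], C2 - P 1 2 * β 3 - 2 * P 1 2 * β 4), (![4, 1, 3], C3 - P 1 3 * β 3 - 2 * P 1 3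
        * β 4), (![4, 2, 0], -B2 * β 3 ^ 3 - 10 * B2 * β 4 ^ 3 + P 2 0 * β 3 ^ 2 + 6 * P 2 0 * β
        4 ^ 2 + 15 * P 3 1 * β 4 ^ 4 - a3 * β 3 ^ 3 - 10 * a3 * β 4 ^ 3 - 18 * B2 * β 3 * β 4 ^ 2
        - 9 * B2 * β 3 ^ 2 * β 4 + 6 * P 2 0 * β 3 * β 4 + 30 * P 3 1 * β 3 * β 4 ^ 3 + 18 * P 3
        1 * β 3 ^ 2 * β 4 ^ 2 + 3 * P 3 1 * β 3 ^ 3 * β 4 - 18 * a3 * β 3 * β 4 ^ 2 - 9 * a3 * β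
        3 ^ 2 * β 4), (![4, 2, 1], P 2 1 * β 3 ^ 2 + 6 * P 2 1 * β 4 ^ 2 - g * τ + Cw * τ * β 3 +
        2 * Cw * τ * β 4 + 6 * P 2 1 * β 3 * β 4), (![4, 2, 2], g - Cw * β 3 - 2 * Cw * β 4 + P 2
        2 * β 3 ^ 2 + 6 * P 2 2 * β 4 ^ 2 + 6 * P 2 2 * β 3 * β 4),
      (![4, 3, 0], -P 3 0 * β 3 ^ 3 - 20 * P 3 0 * β 4 ^ 3 - 30 * P 3 0 * β 3 * β 4 ^ 2 - 12 * P
        3 0 * β 3 ^ 2 * β 4), (![4, 3, 1], -P 3 1 * β 3 ^ 3 - 20 * P 3 1 * β 4 ^ 3 - 30 * P 3 1 *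
        β 3 * β 4 ^ 2 - 12 * P 3 1 * β 3 ^ 2 * β 4), (![4, 4, 0], P 4 0 * β 3 ^ 4 + 70 * P 4 0 *
        β 4 ^ 4 + 140 * P 4 0 * β 3 * β 4 ^ 3 + 90 * P 4 0 * β 3 ^ 2 * β 4 ^ 2 + 20 * P 4 0 * β 3
        ^ 3 * β 4), (![5, 0, 0], -B2 * β 4 ^ 3 - P 1 0 * β 4 ^ 2 - P 2 1 * β 4 ^ 4 + a2 * β 4 ^ 3
        - 2 * B2 * β 3 * β 4 ^ 2 - B2 * β 3 ^ 2 * β 4 - P 1 0 * β 3 * β 4 - 2 * P 2 1 * β 3 * β 4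
        ^ 3 - P 2 1 * β 3 ^ 2 * β 4 ^ 2 + 2 * a2 * β 3 * β 4 ^ 2 + a2 * β 3 ^ 2 * β 4),
      (![5, 0, 1], B3 * β 4 ^ 3 - P 1 1 * β 4 ^ 2 - 2 * P 2 2 * β 4 ^ 4 + 2 * B3 * β 3 * β 4 ^ 2
        + B3 * β 3 ^ 2 * β 4 - P 1 1 * β 3 * β 4 - 4 * P 2 2 * β 3 * β 4 ^ 3 - 2 * P 2 2 * β 3 ^
        2 * β 4 ^ 2), (![5, 0, 2], -P 1 2 * β 4 ^ 2 - P 1 2 * β 3 * β 4),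
      (![5, 0, 3], -P 1 3 * β 4 ^ 2 - P 1 3 * β 3 * β 4), (![5, 1, 0], -5 * B2 * β 4 ^ 4 + 4 * P
        2 0 * β 4 ^ 3 + 6 * P 3 1 * β 4 ^ 5 - 5 * a3 * β 4 ^ 4 - 12 * B2 * β 3 * β 4 ^ 3 - 9 * B2
        * β 3 ^ 2 * β 4 ^ 2 - 2 * B2 * β 3 ^ 3 * β 4 + 6 * P 2 0 * β 3 * β 4 ^ 2 + 2 * P 2 0 * β
        3 ^ 2 * β 4 + 15 * P 3 1 * β 3 * β 4 ^ 4 + 12 * P 3 1 * β 3 ^ 2 * β 4 ^ 3 + 3 * P 3 1 * β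
        3 ^ 3 * β 4 ^ 2 - 12 * a3 * β 3 * β 4 ^ 3 - 9 * a3 * β 3 ^ 2 * β 4 ^ 2 - 2 * a3 * β 3 ^ 3
        * β 4), (![5, 1, 1], 4 * P 2 1 * β 4 ^ 3 + Cw * τ * β 4 ^ 2 + 6 * P 2 1 * β 3 * β 4 ^ 2 +
        2 * P 2 1 * β 3 ^ 2 * β 4 + Cw * τ * β 3 * β 4), (![5, 1, 2], -Cw * β 4 ^ 2 + 4 * P 2 2 *
        β 4 ^ 3 - Cw * β 3 * β 4 + 6 * P 2 2 * β 3 * β 4 ^ 2 + 2 * P 2 2 * β 3 ^ 2 * β 4),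
      (![5, 2, 0], -15 * P 3 0 * β 4 ^ 4 - 30 * P 3 0 * β 3 * β 4 ^ 3 - 18 * P 3 0 * β 3 ^ 2 * β
        4 ^ 2 - 3 * P 3 0 * β 3 ^ 3 * β 4), (![5, 2, 1], -15 * P 3 1 * β 4 ^ 4 - 30 * P 3 1 * β 3
        * β 4 ^ 3 - 18 * P 3 1 * β 3 ^ 2 * β 4 ^ 2 - 3 * P 3 1 * β 3 ^ 3 * β 4),
      (![5, 3, 0], 56 * P 4 0 * β 4 ^ 5 + 140 * P 4 0 * β 3 * β 4 ^ 4 + 120 * P 4 0 * β 3 ^ 2 * β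
        4 ^ 3 + 40 * P 4 0 * β 3 ^ 3 * β 4 ^ 2 + 4 * P 4 0 * β 3 ^ 4 * β 4),
      (![6, 0, 0], -B2 * β 4 ^ 5 + P 2 0 * β 4 ^ 4 + P 3 1 * β 4 ^ 6 - a3 * β 4 ^ 5 - 3 * B2 * β
        3 * β 4 ^ 4 - 3 * B2 * β 3 ^ 2 * β 4 ^ 3 - B2 * β 3 ^ 3 * β 4 ^ 2 + 2 * P 2 0 * β 3 * β 4
        ^ 3 + P 2 0 * β 3 ^ 2 * β 4 ^ 2 + 3 * P 3 1 * β 3 * β 4 ^ 5 + 3 * P 3 1 * β 3 ^ 2 * β 4 ^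
        4 + P 3 1 * β 3 ^ 3 * β 4 ^ 3 - 3 * a3 * β 3 * β 4 ^ 4 - 3 * a3 * β 3 ^ 2 * β 4 ^ 3 - a3
        * β 3 ^ 3 * β 4 ^ 2), (![6, 0, 1], P 2 1 * β 4 ^ 4 + 2 * P 2 1 * β 3 * β 4 ^ 3 + P 2 1 *
        β 3 ^ 2 * β 4 ^ 2), (![6, 0, 2], P 2 2 * β 4 ^ 4 + 2 * P 2 2 * β 3 * β 4 ^ 3 + P 2 2 * β
        3 ^ 2 * β 4 ^ 2), (![6, 1, 0], -6 * P 3 0 * β 4 ^ 5 - 15 * P 3 0 * β 3 * β 4 ^ 4 - 12 * P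
        3 0 * β 3 ^ 2 * β 4 ^ 3 - 3 * P 3 0 * β 3 ^ 3 * β 4 ^ 2),
      (![6, 1, 1], -6 * P 3 1 * β 4 ^ 5 - 15 * P 3 1 * β 3 * β 4 ^ 4 - 12 * P 3 1 * β 3 ^ 2 * β 4
        ^ 3 - 3 * P 3 1 * β 3 ^ 3 * β 4 ^ 2), (![6, 2, 0], 28 * P 4 0 * β 4 ^ 6 + 84 * P 4 0 * β
        3 * β 4 ^ 5 + 90 * P 4 0 * β 3 ^ 2 * β 4 ^ 4 + 40 * P 4 0 * β 3 ^ 3 * β 4 ^ 3 + 6 * P 4 0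
        * β 3 ^ 4 * β 4 ^ 2), (![7, 0, 0], -P 3 0 * β 4 ^ 6 - 3 * P 3 0 * β 3 * β 4 ^ 5 - 3 * P 3
        0 * β 3 ^ 2 * β 4 ^ 4 - P 3 0 * β 3 ^ 3 * β 4 ^ 3), (![7, 0, 1], -P 3 1 * β 4 ^ 6 - 3 * P
        3 1 * β 3 * β 4 ^ 5 - 3 * P 3 1 * β 3 ^ 2 * β 4 ^ 4 - P 3 1 * β 3 ^ 3 * β 4 ^ 3),
      (![7, 1, 0], 8 * P 4 0 * β 4 ^ 7 + 28 * P 4 0 * β 3 * β 4 ^ 6 + 36 * P 4 0 * β 3 ^ 2 * β 4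
        ^ 5 + 20 * P 4 0 * β 3 ^ 3 * β 4 ^ 4 + 4 * P 4 0 * β 3 ^ 4 * β 4 ^ 3),
      (![8, 0, 0], P 4 0 * β 4 ^ 8 + 4 * P 4 0 * β 3 * β 4 ^ 7 + 6 * P 4 0 * β 3 ^ 2 * β 4 ^ 6 +
        4 * P 4 0 * β 3 ^ 3 * β 4 ^ 5 + P 4 0 * β 3 ^ 4 * β 4 ^ 4)] : List ((Fin 3 → ℕ) × F)))
    (by simp only [List.map_cons, List.map_nil]; decide +kernel) (by
      refine mul_ne_zero (X_ne_zero 0) fun h => ?_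
      have := congrArg (eval ![0, 1, 0]) h
      simp at this) (by
      intro v hv
      simp only [map_mul, map_add, eval_X, eval_C] at hv
      have h0 := left_ne_zero_of_mul hv
      have hv' : v = ![v 0, v 1, v 2] := by
        ext i
        fin_cases i <;> rfl
      rw [hv', ← h _ _ (v 2) _ rfl h0 (right_ne_zero_of_mul hv) _ _ rfl rfl]
      simp only [List.map_cons, List.map_nil, List.sum_cons, List.sum_nil, Fin.prod_univ_three,
        Matrix.cons_val]
      generalize v 0 = ξ at *
      generalize v 1 = q
      generalize v 2 = p
      field_simp
      ring)
  simp at key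
  obtain ⟨P04, P13, P22, P31, P40, P03, -, hC3, P12, -, hCw, P21, -, ha3, P30, -, -, h02, -, -, hC2,
    -, h11, -, -, ha2, hB3, h20, -, -, -, -, -, h01, -, -, -, he, -, -, h10, hg, -, -, -, -,
    -, -, -, -⟩ := key
  simp only [P13, P22, P31, P12, P21, zero_mul, mul_zero, add_zero, sub_zero]
    at hC3 hCw ha3 h02 hC2 h11 ha2 hB3 h20 h01 he h10 hg
  obtain rfl : Cw = 0 := by linear_combination hB3 + hCw
  obtain rfl : B3 = 0 := by linear_combination -hCw
  obtain rfl : a2 = B2 := by linear_combination ha2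
  obtain rfl : a3 = -a2 := by linear_combination -ha3
  obtain rfl : e = g := by linear_combination h11 + hg
  have P11 : P 1 1 = -2 * e := by linear_combination -hg
  refine ⟨⟨rfl, rfl, by linear_combination hC2, by linear_combination -hC3, rfl, rfl, rfl, ?_⟩,
    by linear_combination -h01, h02, P03, P04, by linear_combination -h10, P11, P12, P13,
    by linear_combination h20, P21, P22, P30, P31, P40⟩
  -- This is the coefficient of q / ξ, the one that brings in the parameters α_2, α_3 and α_4.
  linear_combination -he + (β 3 + 2 * β 4) * P11

/-! ### The difference of two Hamiltonians is constant -/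

theorem eval_eq_const_of_isRegular {α : Fin 7 → ℂ}
    (hα : α 0 + α 1 + 2 * α 2 + 2 * α 3 + 2 * α 4 + α 5 + α 6 = 1) {K : PolyRing}
    (hK : IsRegular α K) : ∃ c, ∀ v, eval v K = c := by
  obtain ⟨β, hβ⟩ : ∃ β : Fin 7 → TimeField, ∀ i, β i = algebraMap ℂ TimeField (α i) :=
    ⟨_, fun _ => rfl⟩
  have hsum : β 0 + β 1 + 2 * β 2 + 2 * β 3 + 2 * β 4 + β 5 + β 6 = 1 := by
    simp only [hβ]
    rw [← map_one (algebraMap ℂ TimeField), ← hα]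
    simp only [map_add, map_mul, map_ofNat]
  obtain ⟨e, a1, a2, a3, B2, B3, g, C1, C2, C3, Cw, P, ha1, hC1, hf⟩ :=
    exists_reduced_form_of_isRegular hK hβ
  obtain ⟨G, hG⟩ := hK.chart34
  have hR := exists_eval_eq_of_chart34 hβ hG
  have hrel := @relations_of_chart34 TimeField _ _ β time e a1 a2 a3 B2 B3 g C1 C2 C3 Cw P
  obtain ⟨R, hR0⟩ := hR 0 0
  obtain ⟨⟨rfl, rfl, rfl, rfl, rfl, rfl, rfl, he⟩, P01, P02, P03, P04, P10, P11, P12, P13, P20, P21,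
      P22, P30, P31, P40⟩ := hrel (R := R) fun ξ q p ζ hζ hξ0 hζ0 s w hs hw => by
    -- z²w + α_3 z = z(zw + α_3) is -w_3, hence only a simple pole.
    have hw1 : (1 / ζ) ^ 2 * w + β 3 * (1 / ζ) = -1 / ξ := by
      rw [hw, hs]
      field_simp
      ring
    have hw2 : 1 / ζ * w = s := by
      rw [hw]
      field_simp
    have hw3 : (1 / ζ) ^ 2 * w ^ 2 = s ^ 2 := by
      rw [← mul_pow, hw2]
    rw [← hR0 ξ q p ζ hζ hξ0 hζ0, ← hs, ← hw, hf, hw1, mul_assoc e, hw3, hw2]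
    ring
  -- Now a1 = (α_0 + α_1)g and C1 = (α_5 + α_6)g, so the last relation is g times the weighted sum
  -- of the parameters, and that sum is 1.
  obtain rfl : g = 0 := by linear_combination -g * hsum + he - ha1 - hC1
  obtain rfl : a1 = 0 := by linear_combination ha1
  obtain rfl : C1 = 0 := by linear_combination hC1
  simp only [P01, P02, P03, P04, P10, P11, P12, P13, P20, P21, P22, P30, P31, P40] at hf
  -- The terms containing x have become a2 x y (y - 1) w, which is invisible at x = y = 0. At y = 2
  -- the values at x = 1 and x = 0 differ by 2 a2 w, and w has a simple pole in ξ whose coefficient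
  -- is -q².
  obtain rfl : a2 = 0 := by
    obtain ⟨R, hR0⟩ := hR 0 2
    obtain ⟨R', hR1⟩ := hR 1 2
    have h2 := coeff_eq_zero_of_forall_eval (m := (![0, 2, 0], -2 * a2)) (i := 0) (N := 1)
      (D := X 0 * (X 1 + C (β 4) * X 0)) (R := R' - R)
      (L := [(![0, 2, 0], -2 * a2), (![1, 1, 0], -2 * a2 * (2 * β 4 + β 3)),
        (![2, 0, 0], -2 * a2 * (β 4 + β 3) * β 4)])
      (by simp only [List.map_cons, List.map_nil]; decide +kernel) (by
        refine mul_ne_zero (X_ne_zero 0) fun h => ?_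
        have := congrArg (eval ![0, 1, 0]) h
        simp at this) (by
        intro v hv
        simp only [map_mul, map_add, eval_X, eval_C] at hv
        have h0 := left_ne_zero_of_mul hv
        have h1 := right_ne_zero_of_mul hv
        have hv' : v = ![v 0, v 1, v 2] := by
          ext i
          fin_cases i <;> rfl
        rw [map_sub, hv', ← hR0 _ _ (v 2) _ rfl h0 h1, ← hR1 _ _ (v 2) _ rfl h0 h1, hf, hf]
        simp only [List.map_cons, List.map_nil, List.sum_cons, List.sum_nil, Fin.prod_univ_three,
          Matrix.cons_val]
        have : v 0 * ((v 1 + β 4 * v 0) / v 0) = v 1 + β 4 * v 0 := mul_div_cancel₀ _ h0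
        linear_combination 2 * a2 * (v 1 + β 4 * v 0) * this)
      (by simp) (by simp)
    simpa using h2
  refine ⟨P 0 0, fun v => ?_⟩
  have hv : v = ![v 0, v 1, v 2, v 3, v 4, v 5] := by
    ext i
    fin_cases i <;> rfl
  rw [hv, hf]
  ring

/-! ### Cancellation of the correction terms, degree, equations of motion, conclusion -/

theorem exists_algebraMap_sub_eq {u : Fin 6 → PhaseField} {f : PhaseField} (hu : IsCanonical u f)
    {H H' : PolyRing} (h : IsPolyHamiltonianIn (hamDeriv H) u)
    (h' : IsPolyHamiltonianIn (hamDeriv (H' + C 0)) u) :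
    ∃ G : PolyRing, algebraMap PolyRing PhaseField (H - H') = aeval u G := by
  obtain ⟨G, hG⟩ := (isPolyHamiltonianIn_iff hu H).1 h
  obtain ⟨G', hG'⟩ := (isPolyHamiltonianIn_iff hu _).1 h'
  rw [C_0, add_zero] at hG'
  exact ⟨G - G', by rw [map_sub, map_sub, ← hG, ← hG']; ring⟩

theorem totalDegree_mul_le_add {p q : PolyRing} {m n : ℕ} (hp : p.totalDegree ≤ m)
    (hq : q.totalDegree ≤ n) : (p * q).totalDegree ≤ m + n :=
  (totalDegree_mul p q).trans (add_le_add hp hq)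

theorem totalDegree_add_le_max {p q : PolyRing} {m n : ℕ} (hp : p.totalDegree ≤ m)
    (hq : q.totalDegree ≤ n) : (p + q).totalDegree ≤ max m n :=
  (totalDegree_add p q).trans (max_le_max hp hq)

theorem totalDegree_sub_le_max {p q : PolyRing} {m n : ℕ} (hp : p.totalDegree ≤ m)
    (hq : q.totalDegree ≤ n) : (p - q).totalDegree ≤ max m n :=
  (totalDegree_sub p q).trans (max_le_max hp hq)

theorem totalDegree_hamD6_add_C_le (a : Fin 7 → ℂ) (c : TimeField) :
    (hamD6 a + C c).totalDegree ≤ 4 := by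
  have hX : ∀ i, (X i : PolyRing).totalDegree ≤ 1 := fun i => (totalDegree_X i).le
  have hX2 : ∀ i, (X i ^ 2 : PolyRing).totalDegree ≤ 2 := fun i => (totalDegree_X_pow i 2).le
  have hC : ∀ r, (C r : PolyRing).totalDegree ≤ 0 := fun r => (totalDegree_C r).le
  have hα : ∀ r : ℂ, (algebraMap ℂ PolyRing r).totalDegree ≤ 0 := fun r => by
    rw [IsScalarTower.algebraMap_apply ℂ TimeField PolyRing]
    exact hC _
  have h1 : (1 : PolyRing).totalDegree ≤ 0 := totalDegree_one.le
  have h2 : (2 : PolyRing).totalDegree ≤ 0 := by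
    rw [← map_ofNat C 2]
    exact hC _
  simp only [hamD6]
  apply le_trans
  · with_reducible repeat' first
      | apply totalDegree_sub_le_max | apply totalDegree_add_le_max
      | apply totalDegree_mul_le_add
      | exact hX _ | exact hX2 _ | exact hC _ | exact hα _ | exact h1 | exact h2
  · decide

/-- On the line x = y = T, with the other variables 0, the Hamiltonian is a polynomial in T whose
T^4 coefficient is 1 / t, coming from x²y². -/
theorem four_le_totalDegree_hamD6_add_C (a : Fin 7 → ℂ) (c : TimeField) :
    4 ≤ (hamD6 a + C c).totalDegree := by
  let u : Fin 6 → Polynomial TimeField := ![Polynomial.X, Polynomial.X, 0, 0, 0, 0]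
  have h := MvPolynomial.aeval_natDegree_le
    (m := (hamD6 a + C c).totalDegree) (hamD6 a + C c) le_rfl u (n := 1) (by
    intro i
    fin_cases i <;> simp [u])
  rw [mul_one] at h
  refine le_trans ?_ h
  refine Polynomial.le_natDegree_of_ne_zero ?_
  have : aeval u (hamD6 a + C c) = Polynomial.C time⁻¹ * (Polynomial.X ^ 4 - Polynomial.X ^ 3
      + Polynomial.C (algebraMap ℂ TimeField (a 0 + a 1)) * Polynomial.X ^ 2
      + Polynomial.C (time - algebraMap ℂ TimeField (a 1)) * Polynomial.X)
      + Polynomial.C c := by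
    have hα : ∀ r : ℂ, aeval u (algebraMap ℂ PolyRing r) = Polynomial.C
        (algebraMap ℂ TimeField r) := by
      intro r
      rw [IsScalarTower.algebraMap_apply ℂ TimeField PolyRing, MvPolynomial.algebraMap_eq, aeval_C]
      rfl
    have hC : ∀ r : TimeField, aeval u (C r : PolyRing) = Polynomial.C r := fun r => by
      rw [aeval_C]
      rfl
    simp only [hamD6, map_add, map_sub, map_mul, map_pow, aeval_X, hα, hC, u, Matrix.cons_val,
      map_one, map_ofNat]
    ring
  rw [this]
  simp [Polynomial.coeff_X_pow, time_ne_zero, add_mul]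

set_option maxHeartbeats 1000000 in
theorem hamDeriv_hamD6_add_C (a : Fin 7 → ℂ)
    (ha : a 0 + a 1 + 2 * a 2 + 2 * a 3 + 2 * a 4 + a 5 + a 6 = 1) (c : TimeField) (i : Fin 6) :
    hamDeriv (hamD6 a + C c) (coords i) = systemD6 a i := by
  have hcon := con_one_eq ha
  have ht := tt_ne_zero
  have hα : ∀ (r : ℂ) (i : Fin 6), pderiv i (algebraMap ℂ PolyRing r) = 0 := fun r i => by
    rw [IsScalarTower.algebraMap_apply ℂ TimeField PolyRing]
    exact pderiv_C
  have h2 : ∀ i : Fin 6, pderiv i (2 : PolyRing) = 0 := fun i => by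
    rw [← map_ofNat C 2, pderiv_C]
  rw [hamDeriv, totalDeriv_coords]
  have hX : ∀ i, algebraMap PolyRing PhaseField (X i) = coords i := fun _ => rfl
  have hC : algebraMap PolyRing PhaseField (C time) = tt := rfl
  have hCi : algebraMap PolyRing PhaseField (C time⁻¹) = tt⁻¹ := by
    exact map_inv₀ (algebraMap TimeField PhaseField) time
  have hαc : ∀ r : ℂ, algebraMap PolyRing PhaseField
      (algebraMap ℂ PolyRing r) = con r := fun r => by
    rw [← IsScalarTower.algebraMap_apply]; rfl
  have h2c : algebraMap PolyRing PhaseField 2 = 2 := map_ofNat _ 2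
  obtain ⟨b, hb⟩ : ∃ b : Fin 7 → PolyRing, ∀ i, algebraMap ℂ PolyRing (a i) = b i :=
    ⟨_, fun _ => rfl⟩
  replace hα : ∀ i j, pderiv i (b j) = 0 := fun i j => hb j ▸ hα _ i
  replace hαc : ∀ j, algebraMap PolyRing PhaseField (b j) = con (a j) := fun j => hb j ▸ hαc _
  simp only [hamD6, hb]
  fin_cases i <;>
    simp [hamVector, pderiv_X, hα, h2, systemD6, hX, hC, hCi, hαc, h2c] <;>
    field_simp
  · ring
  · ring
  -- In the equations for z and w the system is written with α_4, α_5, α_6 instead of α_0 + α_1 +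
  -- 2α_2 + 2α_3, so the normalisation enters.
  · linear_combination coords 2 * hcon
  · linear_combination -coords 3 * hcon
  · ring
  · ring

theorem exists_eq_hamD6_add_C_of_assumptions {a : Fin 7 → ℂ}
    (ha : a 0 + a 1 + 2 * a 2 + 2 * a 3 + 2 * a 4 + a 5 + a 6 = 1) {H : PolyRing}
    (hH : Assumptions a H) : ∃ c : TimeField, H = hamD6 a + C c := by
  have hdeg : (hamD6 a).totalDegree ≤ 4 := by
    simpa using totalDegree_hamD6_add_C_le a 0
  have hK : IsRegular a (H - hamD6 a) :=
    { degree := (totalDegree_sub _ _).trans (max_le hH.degree.le hdeg)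
      chart0 := exists_algebraMap_sub_eq (isCanonical_r0 a) hH.chart0 (chart0_hamD6 a 0)
      chart1 := exists_algebraMap_sub_eq (isCanonical_r1 a) hH.chart1 (chart1_hamD6 a 0)
      chart2 := exists_algebraMap_sub_eq (isCanonical_r2 a) hH.chart2 (chart2_hamD6 a 0)
      chart3 := exists_algebraMap_sub_eq (isCanonical_r3 a) hH.chart3 (chart3_hamD6 a 0)
      chart5 := exists_algebraMap_sub_eq (isCanonical_r5 a) hH.chart5 (chart5_hamD6 a 0)
      chart6 := exists_algebraMap_sub_eq (isCanonical_r6 a) hH.chart6 (chart6_hamD6 a 0)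
      chart34 := exists_algebraMap_sub_eq (isCanonical_r4_r3 a) hH.chart34
        (chart34_hamD6 a ha 0) }
  obtain ⟨c, hc⟩ := eval_eq_const_of_isRegular ha hK
  refine ⟨c, ?_⟩
  rw [← sub_eq_iff_eq_add']
  exact MvPolynomial.funext fun v => by rw [hc, eval_C]

theorem assumptions_hamD6_add_C {a : Fin 7 → ℂ}
    (ha : a 0 + a 1 + 2 * a 2 + 2 * a 3 + 2 * a 4 + a 5 + a 6 = 1) (c : TimeField) :
    Assumptions a (hamD6 a + C c) :=
  { degree := le_antisymm (totalDegree_hamD6_add_C_le a c) (four_le_totalDegree_hamD6_add_C a c)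
    chart0 := chart0_hamD6 a c
    chart1 := chart1_hamD6 a c
    chart2 := chart2_hamD6 a c
    chart3 := chart3_hamD6 a c
    chart5 := chart5_hamD6 a c
    chart6 := chart6_hamD6 a c
    chart34 := chart34_hamD6 a ha c }

end CoupledPIII

end

theorem theorem2p2 (a : Fin 7 → ℂ)
    (ha : a 0 + a 1 + 2 * a 2 + 2 * a 3 + 2 * a 4 + a 5 + a 6 = 1)
    (H : CoupledPIII.PolyRing) :
    (CoupledPIII.Assumptions a H →
      (∃ c : RatFunc ℂ, H = CoupledPIII.hamD6 a + MvPolynomial.C c) ∧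
        ∀ i, CoupledPIII.hamDeriv H (CoupledPIII.coords i) = CoupledPIII.systemD6 a i) ∧
    ((∃ c : RatFunc ℂ, H = CoupledPIII.hamD6 a + MvPolynomial.C c) →
      CoupledPIII.Assumptions a H) := by
  refine ⟨fun hH => ?_, ?_⟩
  · obtain ⟨c, rfl⟩ := CoupledPIII.exists_eq_hamD6_add_C_of_assumptions ha hH
    exact ⟨⟨c, rfl⟩, CoupledPIII.hamDeriv_hamD6_add_C a ha c⟩
  · rintro ⟨c, rfl⟩
    exact CoupledPIII.assumptions_hamD6_add_C ha c
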